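/- Let $K$ be a field of characteristic different from $2$ and let $X$ be a connected partially ordered set (any two elements of $X$ are joined by a finite sequence in which consecutive elements are comparable). Let $I(X,K)$ be the space of functions $f:X\times X\to K$ with $f(x,y)=0$ whenever $x\nleq y$, and let $FI(X,K)$ be the finitary incidence algebra: the set of all $f\in I(X,K)$ such that for all $x\le y$ there are only finitely many subintervals $[u,v]\subseteq[x,y]$ with $u\ne v$ and $f(u,v)\neq 0$, with product $(fg)(x,y)=\sum_{x\le z\le y}f(x,z)g(z,y)$. For $x\in X$ let $e_x\in FI(X,K)$ be the element with $e_x(x,x)=1$ and all other values $0$. Assume that every multiplicative automorphism of $FI(X,K)$ is inner. Here a multiplicative automorphism is one of the form $M_\sigma(f)(x,y)=\sigma(x,y)f(x,y)$, where $\sigma\in I(X,K)$ satisfies $\sigma(x,y)\ne0$ for all $x\le y$ and $\sigma(x,y)\sigma(y,z)=\sigma(x,z)$ for all $x\le y\le z$. An involution on $X$ is a map $\lambda:X\to X$ with $\lambda^2=\mathrm{id}$ and $x\le y\Leftrightarrow\lambda(y)\le\lambda(x)$. An involution on a $K$-algebra $A$ is an additive map $\rho:A\to A$ with $\rho(ab)=\rho(b)\rho(a)$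 and $\rho^2=\mathrm{id}$; it is of the second kind if it is not the identity on the center of $A$. An involution $\rho$ on $FI(X,K)$ induces $\lambda$ on $X$ if, for every $x\in X$, $\rho(e_x)=ue_{\lambda(x)}u^{-1}$ for some invertible $u\in FI(X,K)$. Let $\lambda_1,\lambda_2$ be involutions on $X$, each with at most one fixed point, and let $\rho_1,\rho_2$ be involutions of the second kind on $FI(X,K)$ that induce $\lambda_1$ and $\lambda_2$ on $X$, respectively. Then there is a $K$-algebra automorphism $\Phi$ of $FI(X,K)$ with $\Phi\circ\rho_1=\rho_2\circ\Phi$ (that is, $\rho_1$ and $\rho_2$ are equivalent) if and only if there is an automorphism $\alpha$ of the poset $X$ with $\alpha\circ\lambda_1=\lambda_2\circ\alpha$ and $\rho_1|_K=\rho_2|_K$, where $K$ is identified with its image in $FI(X,K)$ under $k\mapsto k\cdot 1$. -/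

import Mathlib

/-! ### Involutions on algebras -/

section Involutions

variable {A : Type*}

/-- An additive map `ρ : A → A` is an involution on the algebra `A` if it reverses products and
squares to the identity.  It is not required to be linear over the base field. -/
structure IsAlgInvolution [Ring A] (ρ : A →+ A) : Prop where
  map_mul_rev : ∀ a b : A, ρ (a * b) = ρ b * ρ a
  apply_apply : ∀ a : A, ρ (ρ a) = a

/-- An involution is of the second kind if it does not fix the center of `A` pointwise. -/
structure IsSecondKindInvolution [Ring A] (ρ : A →+ A) : Prop extends IsAlgInvolution ρ where
  not_fix_center : ¬ ∀ a ∈ Subring.center A, ρ a = a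

/-- Two involutions on a `K`-algebra `A` are equivalent if they are intertwined by an automorphism
of the `K`-algebra `A`. -/
def InvolutionsEquivalent (K : Type*) [Field K] [Ring A] [Algebra K A] (ρ₁ ρ₂ : A →+ A) : Prop :=
  ∃ Φ : A ≃ₐ[K] A, ∀ a : A, Φ (ρ₁ a) = ρ₂ (Φ a)

/-- `ρ₁` and `ρ₂` have the same restriction to (the image in `A` of) the base field `K`. -/
def AgreeOnScalars (K : Type*) [Field K] [Ring A] [Algebra K A] (ρ₁ ρ₂ : A →+ A) : Prop :=
  ∀ k : K, ρ₁ (algebraMap K A k) = ρ₂ (algebraMap K A k)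

/-- Inner automorphisms: `a ↦ u a u⁻¹` for an invertible `u`. -/
def IsInnerAut {K : Type*} [Field K] [Ring A] [Algebra K A] (Φ : A ≃ₐ[K] A) : Prop :=
  ∃ u : Aˣ, ∀ a : A, Φ a = (u : A) * a * ((u⁻¹ : Aˣ) : A)

end Involutions

/-! ### Posets -/

section Posets

variable {X : Type*} [PartialOrder X]

/-- Any two elements are joined by a finite sequence of successively comparable elements. -/
def IsConnectedPoset (X : Type*) [PartialOrder X] : Prop :=
  ∀ x y : X, Relation.ReflTransGen (fun a b : X => a ≤ b ∨ b ≤ a) x y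

/-- An involution on the poset `X`: an order-reversing map that squares to the identity. -/
structure IsPosetInvolution (l : X → X) : Prop where
  apply_apply : ∀ x : X, l (l x) = x
  le_iff : ∀ x y : X, x ≤ y ↔ l y ≤ l x

/-- Two involutions on `X` are equivalent if they are conjugate by an automorphism of `X`. -/
def PosetInvolutionsEquivalent (l₁ l₂ : X → X) : Prop :=
  ∃ α : X ≃o X, ∀ x : X, α (l₁ x) = l₂ (α x)

end Posets

/-! ### The finitary incidence algebra -/

section Finitary

variable {K X : Type*} [Field K] [PartialOrder X]

/-- An element `f` of the incidence space is finitary if every interval `[x, y]` contains only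
finitely many subintervals `[u, v]` with `u ≠ v` and `f u v ≠ 0` (a nonempty interval is recorded
by the pair of its endpoints). -/
def IsFinitary (f : IncidenceAlgebra K X) : Prop :=
  ∀ x y : X, {p : X × X | x ≤ p.1 ∧ p.1 < p.2 ∧ p.2 ≤ y ∧ f p.1 p.2 ≠ 0}.Finite

variable (K X) in
/-- The space `FI(X, K)` of finitary elements of the incidence space `I(X, K)`. -/
def finitarySubmodule : Submodule K (IncidenceAlgebra K X) where
  carrier := {f | IsFinitary f}
  zero_mem' := fun x y => by
    convert Set.finite_empty (α := X × X)
    ext p; simp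
  add_mem' := fun {f g} hf hg x y => by
    refine ((hf x y).union (hg x y)).subset ?_
    rintro p ⟨h1, h2, h3, h4⟩
    by_cases h : f p.1 p.2 = 0
    · refine Or.inr ⟨h1, h2, h3, fun h' => h4 ?_⟩
      rw [IncidenceAlgebra.add_apply, h, h', add_zero]
    · exact Or.inl ⟨h1, h2, h3, h⟩
  smul_mem' := fun c f hf x y => by
    refine (hf x y).subset ?_
    rintro p ⟨h1, h2, h3, h4⟩
    refine ⟨h1, h2, h3, fun h => h4 ?_⟩
    rw [IncidenceAlgebra.constSMul_apply, h, smul_zero]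

variable (K X) in
/-- The finitary incidence algebra `FI(X, K)`; its product is the convolution defined below. -/
abbrev FinIncAlg : Type _ := finitarySubmodule K X

namespace FinIncAlg

instance instCoeFun : CoeFun (FinIncAlg K X) (fun _ => X → X → K) := ⟨fun f => ⇑f.1⟩

theorem ext_apply {f g : FinIncAlg K X} (h : ∀ x y : X, x ≤ y → f x y = g x y) : f = g :=
  Subtype.ext (IncidenceAlgebra.ext fun x y hxy => h x y hxy)

theorem apply_of_not_le (f : FinIncAlg K X) {x y : X} (h : ¬ x ≤ y) : f x y = 0 :=
  IncidenceAlgebra.apply_eq_zero_of_not_le h f.1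

theorem le_of_apply_ne_zero (f : FinIncAlg K X) {x y : X} (h : f x y ≠ 0) : x ≤ y :=
  not_not.1 fun h' => h (f.apply_of_not_le h')

/-- The convolution `(f g)(x, y) = ∑_{x ≤ z ≤ y} f(x, z) g(z, y)`; only finitely many terms
are nonzero. -/
noncomputable def conv (f g : FinIncAlg K X) (x y : X) : K :=
  ∑ᶠ z ∈ Set.Icc x y, f x z * g z y

/-- A finite set of elements of `X` that contains `x`, `y` and the endpoints of all nontrivial
subintervals of `[x, y]` on which `f` does not vanish. -/
theorem exists_endpoints (f : FinIncAlg K X) (x y : X) :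
    ∃ S : Finset X, ∀ u v : X, x ≤ u → v ≤ y → u ≠ v → f u v ≠ 0 → u ∈ S ∧ v ∈ S := by
  classical
  refine ⟨(f.2 x y).toFinset.image Prod.fst ∪ (f.2 x y).toFinset.image Prod.snd, ?_⟩
  intro u v hu hv huv h
  have hm : (u, v) ∈ (f.2 x y).toFinset := by
    rw [Set.Finite.mem_toFinset]
    exact ⟨hu, lt_of_le_of_ne (f.le_of_apply_ne_zero h) huv, hv, h⟩
  exact ⟨Finset.mem_union_left _ (Finset.mem_image_of_mem Prod.fst hm),
    Finset.mem_union_right _ (Finset.mem_image_of_mem Prod.snd hm)⟩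

/-- The convolution as a sum over any finite set that is large enough. -/
theorem conv_eq_sum (f g : FinIncAlg K X) (x y : X) (S : Finset X)
    (h : ∀ z : X, f x z ≠ 0 → g z y ≠ 0 → z ∈ S) :
    conv f g x y = ∑ z ∈ S, f x z * g z y := by
  unfold conv
  rw [← finsum_mem_coe_finset]
  refine finsum_mem_inter_support_eq' _ _ _ ?_
  intro z hz
  have hf : f x z ≠ 0 := left_ne_zero_of_mul hz
  have hg : g z y ≠ 0 := right_ne_zero_of_mul hz
  exact ⟨fun _ => h z hf hg, fun _ => ⟨f.le_of_apply_ne_zero hf, g.le_of_apply_ne_zero hg⟩⟩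

theorem exists_of_conv_ne_zero (f g : FinIncAlg K X) {x y : X} (h : conv f g x y ≠ 0) :
    ∃ z, f x z ≠ 0 ∧ g z y ≠ 0 := by
  by_contra hne
  push Not at hne
  refine h ?_
  rw [conv_eq_sum f g x y ∅ (fun z h1 h2 => absurd (hne z h1) h2), Finset.sum_empty]

theorem conv_of_not_le (f g : FinIncAlg K X) {x y : X} (h : ¬ x ≤ y) : conv f g x y = 0 := by
  by_contra hne
  obtain ⟨z, h1, h2⟩ := exists_of_conv_ne_zero f g hne
  exact h ((f.le_of_apply_ne_zero h1).trans (g.le_of_apply_ne_zero h2))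

theorem conv_finitary (f g : FinIncAlg K X) :
    IsFinitary (K := K) (X := X) ⟨conv f g, fun _ _ h => conv_of_not_le f g h⟩ := by
  classical
  intro x y
  obtain ⟨S, hS⟩ := exists_endpoints f x y
  obtain ⟨T, hT⟩ := exists_endpoints g x y
  refine ((S ∪ T) ×ˢ (S ∪ T)).finite_toSet.subset ?_
  rintro ⟨u, v⟩ ⟨h1, h2, h3, h4⟩
  obtain ⟨z, hz1, hz2⟩ := exists_of_conv_ne_zero f g (x := u) (y := v) h4
  have huz := f.le_of_apply_ne_zero hz1
  have hzv := g.le_of_apply_ne_zero hz2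
  simp only [Finset.coe_product, Set.mem_prod, Finset.mem_coe, Finset.mem_union]
  by_cases e1 : u = z
  · subst e1
    have := hT u v h1 h3 h2.ne hz2
    exact ⟨Or.inr this.1, Or.inr this.2⟩
  · have a := hS u z h1 (hzv.trans h3) e1 hz1
    by_cases e2 : z = v
    · subst e2
      exact ⟨Or.inl a.1, Or.inl a.2⟩
    · exact ⟨Or.inl a.1, Or.inr (hT z v (h1.trans huz) h3 e2 hz2).2⟩

noncomputable instance instMul : Mul (FinIncAlg K X) :=
  ⟨fun f g => ⟨⟨conv f g, fun _ _ h => conv_of_not_le f g h⟩, conv_finitary f g⟩⟩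

theorem mul_apply (f g : FinIncAlg K X) (x y : X) :
    (f * g) x y = ∑ᶠ z ∈ Set.Icc x y, f x z * g z y := rfl

theorem mul_apply_eq_sum (f g : FinIncAlg K X) (x y : X) (S : Finset X)
    (h : ∀ z : X, f x z ≠ 0 → g z y ≠ 0 → z ∈ S) :
    (f * g) x y = ∑ z ∈ S, f x z * g z y := conv_eq_sum f g x y S h

open Classical in
/-- The element `e_Y` with `e_Y(u, v) = 1` if `u = v ∈ Y` and `0` otherwise. -/
noncomputable def diagSet (Y : Set X) : FinIncAlg K X :=
  ⟨⟨fun u v => if u = v ∧ u ∈ Y then 1 else 0,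
    fun u v h => if_neg fun h' => h h'.1.le⟩, fun x y => by
      convert Set.finite_empty (α := X × X)
      ext ⟨u, v⟩
      simp only [Set.mem_ofPred_eq, Set.mem_empty_iff_false, iff_false]
      rintro ⟨_, h2, _, h4⟩
      exact h4 (if_neg fun h' => h2.ne h'.1)⟩

open Classical in
theorem diagSet_apply (Y : Set X) (u v : X) :
    (diagSet Y : FinIncAlg K X) u v = if u = v ∧ u ∈ Y then 1 else 0 := rfl

/-- The idempotent `e_x`, with value `1` at `(x, x)` and `0` elsewhere. -/
noncomputable def e (x : X) : FinIncAlg K X := diagSet {x}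

/-- The unity `δ`. -/
noncomputable instance instOne : One (FinIncAlg K X) := ⟨diagSet Set.univ⟩

open Classical in
theorem one_apply (x y : X) : (1 : FinIncAlg K X) x y = if x = y then 1 else 0 := by
  refine (diagSet_apply Set.univ x y).trans ?_
  simp only [Set.mem_univ, and_true]

theorem add_apply (f g : FinIncAlg K X) (x y : X) : (f + g) x y = f x y + g x y := rfl

theorem smul_apply (c : K) (f : FinIncAlg K X) (x y : X) : (c • f) x y = c * f x y := rfl

theorem zero_apply (x y : X) : (0 : FinIncAlg K X) x y = 0 := rfl

/-- A finite set of elements over which all the convolutions of `f`, `g`, `h` on `[x, y]` can be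
computed. -/
theorem exists_common₃ (f g h : FinIncAlg K X) (x y : X) :
    ∃ S : Finset X, x ∈ S ∧ y ∈ S ∧
      (∀ u v : X, x ≤ u → v ≤ y → f u v ≠ 0 → (u ∈ S ↔ v ∈ S)) ∧
      (∀ u v : X, x ≤ u → v ≤ y → g u v ≠ 0 → (u ∈ S ↔ v ∈ S)) ∧
      (∀ u v : X, x ≤ u → v ≤ y → h u v ≠ 0 → (u ∈ S ↔ v ∈ S)) := by
  classical
  obtain ⟨S, hS⟩ := exists_endpoints f x y
  obtain ⟨T, hT⟩ := exists_endpoints g x y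
  obtain ⟨U, hU⟩ := exists_endpoints h x y
  refine ⟨{x, y} ∪ S ∪ T ∪ U, by simp, by simp, ?_, ?_, ?_⟩ <;> intro u v hu hv hn <;>
    by_cases e : u = v
  · rw [e]
  · simp [hS u v hu hv e hn]
  · rw [e]
  · simp [hT u v hu hv e hn]
  · rw [e]
  · simp [hU u v hu hv e hn]

protected theorem mul_assoc (f g h : FinIncAlg K X) : f * g * h = f * (g * h) := by
  refine ext_apply fun x y _ => ?_
  obtain ⟨S, hx, hy, hf, hg, hh⟩ := exists_common₃ f g h x y
  have key1 : (f * g * h) x y = ∑ w ∈ S, (∑ z ∈ S, f x z * g z w) * h w y := by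
    rw [mul_apply_eq_sum (f * g) h x y S]
    · refine Finset.sum_congr rfl fun w _ => ?_
      by_cases hw : h w y = 0
      · rw [hw, mul_zero, mul_zero]
      · have hwy := h.le_of_apply_ne_zero hw
        rw [mul_apply_eq_sum f g x w S]
        intro z h1 h2
        exact (hf x z le_rfl ((g.le_of_apply_ne_zero h2).trans hwy) h1).1 hx
    · intro w h1 h2
      exact (hh w y ((f * g).le_of_apply_ne_zero h1) le_rfl h2).2 hy
  have key2 : (f * (g * h)) x y = ∑ z ∈ S, f x z * ∑ w ∈ S, g z w * h w y := by
    rw [mul_apply_eq_sum f (g * h) x y S]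
    · refine Finset.sum_congr rfl fun z _ => ?_
      by_cases hz : f x z = 0
      · rw [hz, zero_mul, zero_mul]
      · have hxz := f.le_of_apply_ne_zero hz
        rw [mul_apply_eq_sum g h z y S]
        intro w h1 h2
        exact (hh w y (hxz.trans (g.le_of_apply_ne_zero h1)) le_rfl h2).2 hy
    · intro z h1 h2
      exact (hf x z le_rfl ((g * h).le_of_apply_ne_zero h2) h1).1 hx
  rw [key1, key2]
  simp only [Finset.sum_mul, Finset.mul_sum]
  rw [Finset.sum_comm]
  simp only [mul_assoc]

protected theorem one_mul (f : FinIncAlg K X) : 1 * f = f := by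
  classical
  refine ext_apply fun x y _ => ?_
  rw [mul_apply_eq_sum 1 f x y {x}]
  · simp [one_apply]
  · intro z h1 _
    rw [one_apply] at h1
    simp only [ne_eq, ite_eq_right_iff, not_forall] at h1
    simp [h1.1]

protected theorem mul_one (f : FinIncAlg K X) : f * 1 = f := by
  classical
  refine ext_apply fun x y _ => ?_
  rw [mul_apply_eq_sum f 1 x y {y}]
  · simp [one_apply]
  · intro z _ h1
    rw [one_apply] at h1
    simp only [ne_eq, ite_eq_right_iff, not_forall] at h1
    simp [h1.1]

protected theorem mul_add (f g h : FinIncAlg K X) : f * (g + h) = f * g + f * h := by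
  refine ext_apply fun x y _ => ?_
  obtain ⟨S, hx, hy, hf, -, -⟩ := exists_common₃ f g h x y
  have H : ∀ k : FinIncAlg K X, (f * k) x y = ∑ z ∈ S, f x z * k z y := fun k =>
    mul_apply_eq_sum f k x y S fun z h1 h2 => (hf x z le_rfl (k.le_of_apply_ne_zero h2) h1).1 hx
  rw [add_apply, H, H, H, ← Finset.sum_add_distrib]
  simp only [add_apply, mul_add]

protected theorem add_mul (f g h : FinIncAlg K X) : (f + g) * h = f * h + g * h := by
  refine ext_apply fun x y _ => ?_
  obtain ⟨S, hx, hy, -, -, hh⟩ := exists_common₃ f g h x y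
  have H : ∀ k : FinIncAlg K X, (k * h) x y = ∑ z ∈ S, k x z * h z y := fun k =>
    mul_apply_eq_sum k h x y S fun z h1 h2 => (hh z y (k.le_of_apply_ne_zero h1) le_rfl h2).2 hy
  rw [add_apply, H, H, H, ← Finset.sum_add_distrib]
  simp only [add_apply, add_mul]

protected theorem smul_mul (c : K) (f g : FinIncAlg K X) : (c • f) * g = c • (f * g) := by
  refine ext_apply fun x y _ => ?_
  obtain ⟨S, hx, hy, -, -, hg⟩ := exists_common₃ f f g x y
  have H : ∀ k : FinIncAlg K X, (k * g) x y = ∑ z ∈ S, k x z * g z y := fun k =>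
    mul_apply_eq_sum k g x y S fun z h1 h2 => (hg z y (k.le_of_apply_ne_zero h1) le_rfl h2).2 hy
  rw [smul_apply, H, H, Finset.mul_sum]
  simp only [smul_apply, mul_assoc]

protected theorem mul_smul (c : K) (f g : FinIncAlg K X) : f * (c • g) = c • (f * g) := by
  refine ext_apply fun x y _ => ?_
  obtain ⟨S, hx, hy, hf, -, -⟩ := exists_common₃ f g g x y
  have H : ∀ k : FinIncAlg K X, (f * k) x y = ∑ z ∈ S, f x z * k z y := fun k =>
    mul_apply_eq_sum f k x y S fun z h1 h2 => (hf x z le_rfl (k.le_of_apply_ne_zero h2) h1).1 hx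
  rw [smul_apply, H, H, Finset.mul_sum]
  simp only [smul_apply, mul_left_comm]

protected theorem zero_mul (f : FinIncAlg K X) : 0 * f = 0 := by
  refine ext_apply fun x y _ => ?_
  simp [mul_apply_eq_sum 0 f x y ∅ fun z h1 _ => absurd (zero_apply x z) h1]

protected theorem mul_zero (f : FinIncAlg K X) : f * 0 = 0 := by
  refine ext_apply fun x y _ => ?_
  simp [mul_apply_eq_sum f 0 x y ∅ fun z _ h1 => absurd (zero_apply z y) h1]

noncomputable instance instRing : Ring (FinIncAlg K X) where
  __ := (inferInstance : AddCommGroup (finitarySubmodule K X))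
  mul := (· * ·)
  one := 1
  mul_assoc := FinIncAlg.mul_assoc
  one_mul := FinIncAlg.one_mul
  mul_one := FinIncAlg.mul_one
  left_distrib := FinIncAlg.mul_add
  right_distrib := FinIncAlg.add_mul
  zero_mul := FinIncAlg.zero_mul
  mul_zero := FinIncAlg.mul_zero

noncomputable instance instAlgebra : Algebra K (FinIncAlg K X) :=
  Algebra.ofModule FinIncAlg.smul_mul FinIncAlg.mul_smul

/-- The elements `σ` of the incidence space that define multiplicative automorphisms. -/
structure IsMultiplicative (σ : IncidenceAlgebra K X) : Prop where
  ne_zero : ∀ x y : X, x ≤ y → σ x y ≠ 0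
  mul_eq : ∀ x y z : X, x ≤ y → y ≤ z → σ x y * σ y z = σ x z

/-- The multiplicative automorphisms `M_σ`, with `M_σ(f)(x, y) = σ(x, y) f(x, y)`. -/
def IsMultiplicativeAut (Φ : FinIncAlg K X ≃ₐ[K] FinIncAlg K X) : Prop :=
  ∃ σ : IncidenceAlgebra K X, IsMultiplicative σ ∧
    ∀ (f : FinIncAlg K X) (x y : X), (Φ f) x y = σ x y * f x y

/-- The involution `ρ` on `FI(X, K)` induces the map `l` on `X`: for every `x` the idempotent
`ρ(e_x)` is conjugate to `e_{l(x)}`. -/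
def Induces (ρ : FinIncAlg K X →+ FinIncAlg K X) (l : X → X) : Prop :=
  ∀ x : X, ∃ u : (FinIncAlg K X)ˣ,
    ρ (e x) = (u : FinIncAlg K X) * e (l x) * ((u⁻¹ : (FinIncAlg K X)ˣ) : FinIncAlg K X)

end FinIncAlg

end Finitary

open scoped PowerSeries

/-! ### Entries of products, matrix units and the center -/

namespace FinIncAlg

variable {K X : Type*} [Field K] [PartialOrder X]

/-! Taking the diagonal entry at a point is multiplicative with values in a commutative field, hence
constant on conjugacy classes; in particular the `e x` are pairwise non-conjugate. An idempotent is
conjugate to its diagonal, and `e x` is minimal because `e x * f * e x` is a multiple of `e x`. So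
an automorphism Φ permutes the classes of the `e x`, which gives a poset automorphism; if Φ
intertwines ρ₁ and ρ₂, this automorphism intertwines λ₁ and λ₂. The center is K by connectedness and
Φ fixes it, so the restrictions to K agree.

Conversely, relabelling along α reduces to λ₁ = λ₂ = λ. Then ρ₂ρ₁ is a K-linear automorphism
preserving the diagonals of the `e x`; such a map is conjugate to a multiplicative automorphism,
hence inner (`isInnerAut_of_map_e_apply_self`). So ρ₂ is ρ₁ followed by conjugation by a unit v, and
ρ₁(v) = kv with kτ(k) = 1, where τ is the action on K. As τ ≠ id, Hilbert 90 rescales v so that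
ρ₁(v) = v. It remains to write v = s·wρ₁(w) with s a scalar (`exists_eq_smul_mul_map`), since
conjugation by w is then an equivalence. The diagonal is treated orbit by orbit under λ, with s
absorbing the entry at the only possible fixed point; the unipotent rest has a unique unipotent
square root, which is therefore fixed by ρ₁. -/

theorem sub_apply (f g : FinIncAlg K X) (x y : X) : (f - g) x y = f x y - g x y := rfl

theorem mul_apply_self (f g : FinIncAlg K X) (x : X) : (f * g) x x = f x x * g x x := by
  rw [mul_apply_eq_sum f g x x {x}, Finset.sum_singleton]
  intro z h1 h2
  exact Finset.mem_singleton.2 (le_antisymm (g.le_of_apply_ne_zero h2) (f.le_of_apply_ne_zero h1))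

theorem one_apply_self (x : X) : (1 : FinIncAlg K X) x x = 1 := by
  rw [one_apply, if_pos rfl]

theorem exists_of_mul_apply_ne_zero (f g : FinIncAlg K X) {x y : X} (h : (f * g) x y ≠ 0) :
    ∃ z, f x z ≠ 0 ∧ g z y ≠ 0 :=
  exists_of_conv_ne_zero f g h

theorem algebraMap_apply_self (k : K) (x : X) : (algebraMap K (FinIncAlg K X) k) x x = k := by
  rw [Algebra.algebraMap_eq_smul_one, smul_apply, one_apply_self, mul_one]

open Classical in
theorem e_apply (x u v : X) : (e x : FinIncAlg K X) u v = if u = v ∧ u = x then 1 else 0 :=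
  diagSet_apply {x} u v

theorem e_apply_self (x : X) : (e x : FinIncAlg K X) x x = 1 := by
  rw [e_apply, if_pos ⟨rfl, rfl⟩]

open Classical in
theorem diagSet_mul_apply (Y : Set X) (f : FinIncAlg K X) (x y : X) :
    (diagSet Y * f : FinIncAlg K X) x y = if x ∈ Y then f x y else 0 := by
  rw [mul_apply_eq_sum _ f x y {x}, Finset.sum_singleton, diagSet_apply]
  · simp
  · intro z h1 _
    rw [diagSet_apply] at h1
    by_contra h
    exact h1 (if_neg fun h' => h (by simp [h'.1]))

open Classical in
theorem mul_diagSet_apply (Y : Set X) (f : FinIncAlg K X) (x y : X) :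
    (f * diagSet Y : FinIncAlg K X) x y = if y ∈ Y then f x y else 0 := by
  rw [mul_apply_eq_sum f _ x y {y}, Finset.sum_singleton, diagSet_apply]
  · simp
  · intro z _ h1
    rw [diagSet_apply] at h1
    by_contra h
    exact h1 (if_neg fun h' => h (by simp [h'.1]))

open Classical in
theorem e_mul_apply (z : X) (f : FinIncAlg K X) (x y : X) :
    (e z * f : FinIncAlg K X) x y = if x = z then f x y else 0 := diagSet_mul_apply {z} f x y

open Classical in
theorem mul_e_apply (z : X) (f : FinIncAlg K X) (x y : X) :
    (f * e z : FinIncAlg K X) x y = if y = z then f x y else 0 := mul_diagSet_apply {z} f x y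

theorem diagSet_mul_diagSet (Y Z : Set X) :
    (diagSet Y * diagSet Z : FinIncAlg K X) = diagSet (Y ∩ Z) := by
  classical
  refine ext_apply fun x y _ => ?_
  rw [diagSet_mul_apply, diagSet_apply, diagSet_apply]
  by_cases h : x ∈ Y <;> simp [h]

theorem e_mul_e_self (x : X) : (e x * e x : FinIncAlg K X) = e x := by
  rw [e, diagSet_mul_diagSet, Set.inter_self]

theorem e_mul_e_of_ne {x y : X} (h : x ≠ y) : (e x * e y : FinIncAlg K X) = 0 := by
  refine ext_apply fun u v _ => ?_
  rw [e_mul_apply, e_apply, zero_apply]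
  split_ifs with h1 h2
  · exact absurd (h1.symm.trans h2.2) h
  · rfl
  · rfl

open Classical in
/-- The matrix unit with value `1` at `(x, y)` and `0` elsewhere. -/
noncomputable def single (x y : X) (h : x ≤ y) : FinIncAlg K X :=
  ⟨⟨fun u v => if u = x ∧ v = y then 1 else 0, fun u v huv =>
      if_neg fun h' => huv (by rw [h'.1, h'.2]; exact h)⟩, fun a b => by
    refine (Set.finite_singleton (x, y)).subset ?_
    rintro ⟨u, v⟩ ⟨-, -, -, h4⟩
    by_contra hne
    exact h4 (if_neg fun h' => hne (Prod.ext h'.1 h'.2))⟩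

open Classical in
theorem single_apply (x y : X) (h : x ≤ y) (u v : X) :
    (single x y h : FinIncAlg K X) u v = if u = x ∧ v = y then 1 else 0 := rfl

theorem single_apply_self (x y : X) (h : x ≤ y) : (single x y h : FinIncAlg K X) x y = 1 := by
  rw [single_apply, if_pos ⟨rfl, rfl⟩]

theorem e_mul_mul_e (f : FinIncAlg K X) (x y : X) (h : x ≤ y) :
    e x * f * e y = f x y • single x y h := by
  refine ext_apply fun u v _ => ?_
  rw [mul_e_apply, e_mul_apply, smul_apply, single_apply]
  by_cases h1 : u = x <;> by_cases h2 : v = y <;> simp [h1, h2]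

theorem single_self (x : X) : (single x x le_rfl : FinIncAlg K X) = e x := by
  classical
  refine ext_apply fun u v _ => ?_
  rw [single_apply, e_apply]
  refine if_congr ⟨?_, ?_⟩ rfl rfl
  · rintro ⟨rfl, rfl⟩
    exact ⟨rfl, rfl⟩
  · rintro ⟨rfl, rfl⟩
    exact ⟨rfl, rfl⟩

theorem e_mul_mul_e_self (f : FinIncAlg K X) (x : X) : e x * f * e x = f x x • e x := by
  rw [e_mul_mul_e f x x le_rfl, single_self]

/-- Over a connected poset the center consists of the scalars. -/
theorem eq_algebraMap_of_commute (hX : IsConnectedPoset X) (f : FinIncAlg K X)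
    (hf : ∀ g : FinIncAlg K X, f * g = g * f) (x₀ : X) :
    f = algebraMap K (FinIncAlg K X) (f x₀ x₀) := by
  classical
  have hoff : ∀ x y : X, x ≠ y → f x y = 0 := by
    intro x y hxy
    have := congrArg (fun g : FinIncAlg K X => g x y) (hf (e x))
    simp only [mul_e_apply, e_mul_apply, if_true, if_neg hxy.symm] at this
    exact this.symm
  -- Commuting with the matrix unit at (x, y) equates the two diagonal entries; connectedness then
  -- propagates the value.
  have hle : ∀ x y : X, x ≤ y → f x x = f y y := by
    intro x y hxy
    have := congrArg (fun g : FinIncAlg K X => g x y) (hf (single x y hxy))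
    rw [mul_apply_eq_sum _ _ x y {x}, mul_apply_eq_sum _ _ x y {y}] at this
    · simpa [single_apply_self] using this
    · intro z h1 _
      rw [single_apply] at h1
      by_contra h
      exact h1 (if_neg fun h' => h (by simp [h'.2]))
    · intro z _ h1
      rw [single_apply] at h1
      by_contra h
      exact h1 (if_neg fun h' => h (by simp [h'.1]))
  have hconst : ∀ x : X, f x x = f x₀ x₀ := by
    intro x
    induction hX x₀ x with
    | refl => rfl
    | tail _ h ih =>
      rcases h with h | h
      · rw [← hle _ _ h, ih]
      · rw [hle _ _ h, ih]
  refine ext_apply fun x y _ => ?_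
  rw [Algebra.algebraMap_eq_smul_one, smul_apply, one_apply]
  split_ifs with h
  · rw [← h, hconst, mul_one]
  · rw [hoff x y h, mul_zero]

/-! ### Power series in elements of zero diagonal: inverses and square roots -/

section PowerSeries

/-- A nonzero entry of `m ^ k` yields a strict chain of k steps along nonzero entries of `m`, whose
points after `u` all lie in `S`. The clause `u < t` ensures that each new point of the chain is
distinct from the earlier ones. -/
theorem pow_apply_ne_zero_le_card {m : FinIncAlg K X} (hm : ∀ x, m x x = 0) {x y : X}
    {S : Finset X}
    (hS : ∀ u v : X, x ≤ u → v ≤ y → u ≠ v → m u v ≠ 0 → u ∈ S ∧ v ∈ S) (k : ℕ) :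
    ∀ u v : X, x ≤ u → v ≤ y → (m ^ k) u v ≠ 0 →
      ∃ T ⊆ S, T.card = k ∧ ∀ t ∈ T, u < t := by
  classical
  induction k with
  | zero => exact fun u v _ _ _ => ⟨∅, by simp, rfl, by simp⟩
  | succ k ih =>
    intro u v hu hv h
    rw [pow_succ'] at h
    obtain ⟨z, h1, h2⟩ := exists_of_mul_apply_ne_zero _ _ h
    have huz := m.le_of_apply_ne_zero h1
    have hne : u ≠ z := by
      rintro rfl
      exact h1 (hm u)
    obtain ⟨T, hTS, hTk, hT⟩ := ih z v (hu.trans huz) hv h2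
    have hz := (hS u z hu (((m ^ k).le_of_apply_ne_zero h2).trans hv) hne h1).2
    refine ⟨insert z T, Finset.insert_subset hz hTS, ?_, ?_⟩
    · rw [Finset.card_insert_of_notMem (fun h' => (hT z h').false), hTk]
    · intro t ht
      rcases Finset.mem_insert.1 ht with rfl | ht
      · exact lt_of_le_of_ne huz hne
      · exact (lt_of_le_of_ne huz hne).trans (hT t ht)

/-- The powers of an element with zero diagonal vanish eventually on each interval. -/
theorem exists_pow_apply_eq_zero {m : FinIncAlg K X} (hm : ∀ x, m x x = 0) (x y : X) :
    ∃ N, ∀ k, N ≤ k → ∀ u v : X, x ≤ u → v ≤ y → (m ^ k) u v = 0 := by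
  obtain ⟨S, hS⟩ := exists_endpoints m x y
  refine ⟨S.card + 1, fun k hk u v hu hv => ?_⟩
  by_contra h
  obtain ⟨T, hTS, hTk, -⟩ := pow_apply_ne_zero_le_card hm hS k u v hu hv h
  have := Finset.card_le_card hTS
  omega

/-- The value at `(x, y)` of a power series evaluated at an element with zero diagonal. -/
noncomputable def seriesValue (m : FinIncAlg K X) (p : K⟦X⟧) (x y : X) : K :=
  ∑ᶠ k, PowerSeries.coeff k p * (m ^ k) x y

theorem sum_apply {ι : Type*} (s : Finset ι) (F : ι → FinIncAlg K X) (x y : X) :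
    (∑ i ∈ s, F i) x y = ∑ i ∈ s, F i x y := by
  classical
  induction s using Finset.induction_on with
  | empty => simp
  | insert a s ha ih => rw [Finset.sum_insert ha, Finset.sum_insert ha, add_apply, ih]

theorem aeval_trunc_apply (m : FinIncAlg K X) (p : K⟦X⟧) (N : ℕ) (x y : X) :
    (Polynomial.aeval m (p.trunc N)) x y =
      ∑ k ∈ Finset.range N, PowerSeries.coeff k p * (m ^ k) x y := by
  rw [Polynomial.aeval_def, PowerSeries.eval₂_trunc_eq_sum_range, sum_apply]
  refine Finset.sum_congr rfl fun k _ => ?_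
  rw [← Algebra.smul_def, smul_apply]

theorem seriesValue_eq {m : FinIncAlg K X} {u v : X} {N : ℕ}
    (hN : ∀ k, N ≤ k → (m ^ k) u v = 0) (p : K⟦X⟧) :
    seriesValue m p u v = (Polynomial.aeval m (p.trunc N)) u v := by
  rw [aeval_trunc_apply, seriesValue]
  refine finsum_eq_sum_of_support_subset _ fun k hk => ?_
  rw [Finset.coe_range, Set.mem_Iio]
  by_contra h
  exact hk (by simp [hN k (not_lt.1 h)])

/-- Evaluation of power series at an element with zero diagonal. -/
noncomputable def seriesEval (m : FinIncAlg K X) (hm : ∀ x, m x x = 0) (p : K⟦X⟧) :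
    FinIncAlg K X :=
  ⟨⟨seriesValue m p, fun u v h => by
      rw [seriesValue_eq (N := 0) fun k _ => (m ^ k).apply_of_not_le h]
      exact apply_of_not_le _ h⟩, fun x y => by
    -- The bound N serves all subintervals of [x, y] at once, so there the series agrees with a
    -- single polynomial in `m`, which is finitary.
    obtain ⟨N, hN⟩ := exists_pow_apply_eq_zero hm x y
    refine ((Polynomial.aeval m (p.trunc N)).2 x y).subset ?_
    rintro ⟨u, v⟩ ⟨h1, h2, h3, h4⟩
    refine ⟨h1, h2, h3, fun h => h4 ?_⟩
    exact (seriesValue_eq (fun k hk => hN k hk u v h1 h3) p).trans h⟩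

theorem seriesEval_eq {m : FinIncAlg K X} (hm : ∀ x, m x x = 0) {u v : X} {N : ℕ}
    (hN : ∀ k, N ≤ k → (m ^ k) u v = 0) (p : K⟦X⟧) :
    seriesEval m hm p u v = (Polynomial.aeval m (p.trunc N)) u v :=
  seriesValue_eq hN p

theorem mul_apply_congr {f f' g g' : FinIncAlg K X} {x y : X}
    (hf : ∀ z, z ≤ y → f x z = f' x z) (hg : ∀ z, x ≤ z → g z y = g' z y) :
    (f * g) x y = (f' * g') x y := by
  rw [mul_apply, mul_apply]
  refine finsum_mem_congr rfl fun z hz => ?_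
  rw [hf z hz.2, hg z hz.1]

theorem aeval_apply_eq_aeval_trunc {m : FinIncAlg K X} {u v : X} {N : ℕ}
    (hN : ∀ k, N ≤ k → (m ^ k) u v = 0) (p : Polynomial K) :
    (Polynomial.aeval m p) u v = (Polynomial.aeval m ((p : K⟦X⟧).trunc N)) u v := by
  rw [aeval_trunc_apply, Polynomial.aeval_eq_sum_range, sum_apply]
  simp only [smul_apply, Polynomial.coeff_coe]
  have h1 : ∑ k ∈ Finset.range N, p.coeff k * (m ^ k) u v =
      ∑ k ∈ Finset.range (max N (p.natDegree + 1)), p.coeff k * (m ^ k) u v := by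
    refine Finset.sum_subset (Finset.range_mono (le_max_left _ _)) fun k _ hk => ?_
    rw [hN k (by simpa using hk), mul_zero]
  have h2 : ∑ k ∈ Finset.range (p.natDegree + 1), p.coeff k * (m ^ k) u v =
      ∑ k ∈ Finset.range (max N (p.natDegree + 1)), p.coeff k * (m ^ k) u v := by
    refine Finset.sum_subset (Finset.range_mono (le_max_right _ _)) fun k _ hk => ?_
    rw [Polynomial.coeff_eq_zero_of_natDegree_lt (by simpa using hk), zero_mul]
  rw [h1, h2]

theorem seriesEval_coe {m : FinIncAlg K X} (hm : ∀ x, m x x = 0) (p : Polynomial K) :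
    seriesEval m hm (p : K⟦X⟧) = Polynomial.aeval m p := by
  refine ext_apply fun x y _ => ?_
  obtain ⟨N, hN⟩ := exists_pow_apply_eq_zero hm x y
  have hN' := fun k hk => hN k hk x y le_rfl le_rfl
  rw [seriesEval_eq hm hN', ← aeval_apply_eq_aeval_trunc hN']

theorem seriesEval_mul {m : FinIncAlg K X} (hm : ∀ x, m x x = 0) (p q : K⟦X⟧) :
    seriesEval m hm (p * q) = seriesEval m hm p * seriesEval m hm q := by
  refine ext_apply fun x y _ => ?_
  obtain ⟨N, hN⟩ := exists_pow_apply_eq_zero hm x y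
  have hN' := fun k hk => hN k hk x y le_rfl le_rfl
  rw [mul_apply_congr (f' := Polynomial.aeval m (p.trunc N)) (g' := Polynomial.aeval m (q.trunc N))
      (fun z hz => seriesEval_eq hm (fun k hk => hN k hk x z le_rfl hz) p)
      (fun z hz => seriesEval_eq hm (fun k hk => hN k hk z y hz le_rfl) q),
    ← map_mul, aeval_apply_eq_aeval_trunc hN', seriesEval_eq hm hN', Polynomial.coe_mul,
    PowerSeries.trunc_trunc_mul_trunc]

theorem seriesEval_apply_self {m : FinIncAlg K X} (hm : ∀ x, m x x = 0) (p : K⟦X⟧) (x : X) :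
    seriesEval m hm p x x = PowerSeries.constantCoeff p := by
  have hN : ∀ k, 1 ≤ k → (m ^ k) x x = 0 := by
    intro k hk
    obtain ⟨j, rfl⟩ := Nat.exists_eq_add_of_le' hk
    rw [pow_succ, mul_apply_self, hm, mul_zero]
  rw [seriesEval_eq hm hN, aeval_trunc_apply]
  simp [one_apply_self]

/-- The inverse is the geometric series 1/(1 - X) evaluated at `1 - f`. -/
theorem isUnit_of_unipotent {f : FinIncAlg K X} (hf : ∀ x, f x x = 1) : IsUnit f := by
  have hm : ∀ x, (1 - f) x x = 0 := fun x => by rw [sub_apply, one_apply_self, hf, sub_self]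
  have h1 : seriesEval (1 - f) hm (1 - PowerSeries.X) = f := by
    have := seriesEval_coe hm (1 - Polynomial.X)
    simpa using this
  have h0 : seriesEval (1 - f) hm 1 = 1 := by
    have := seriesEval_coe hm 1
    simpa using this
  have hu : IsUnit (1 - PowerSeries.X : K⟦X⟧) := by
    rw [PowerSeries.isUnit_iff_constantCoeff]
    simp
  obtain ⟨q, hq⟩ := hu.exists_right_inv
  refine isUnit_iff_exists.2 ⟨seriesEval (1 - f) hm q, ?_, ?_⟩
  · rw [← hq, seriesEval_mul, h1] at h0
    exact h0
  · rw [← hq, mul_comm, seriesEval_mul, h1] at h0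
    exact h0

/-- The Catalan series C satisfies C = 1 + XC², so s = 1 - 2XC squares to 1 - 4X. Its coefficients
are integers, so this needs no assumption on the characteristic. -/
theorem exists_sq_eq_one_sub_four_X :
    ∃ s : K⟦X⟧, PowerSeries.constantCoeff s = 1 ∧ s * s = 1 - 4 * PowerSeries.X := by
  set C : K⟦X⟧ := PowerSeries.map (Nat.castRingHom K) PowerSeries.catalanSeries
  have hC : C ^ 2 * PowerSeries.X + 1 = C := by
    have := congrArg (PowerSeries.map (Nat.castRingHom K))
      PowerSeries.catalanSeries_sq_mul_X_add_one
    simpa using this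
  refine ⟨1 - 2 * PowerSeries.X * C, by simp, ?_⟩
  linear_combination (4 * PowerSeries.X) * hC

/-- In characteristic different from `2` unipotent elements have unipotent square roots. -/
theorem exists_unipotent_mul_self_eq (h2 : (2 : K) ≠ 0) {f : FinIncAlg K X}
    (hf : ∀ x, f x x = 1) : ∃ r : FinIncAlg K X, (∀ x, r x x = 1) ∧ r * r = f := by
  obtain ⟨s, hs1, hs⟩ := exists_sq_eq_one_sub_four_X (K := K)
  have h4 : (4 : K) ≠ 0 := by
    have : (4 : K) = 2 * 2 := by norm_num
    rw [this]
    exact mul_ne_zero h2 h2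
  -- Chosen so that f = 1 - 4m; the characteristic enters only through this division.
  set m : FinIncAlg K X := (4 : K)⁻¹ • (1 - f) with hmdef
  have hm : ∀ x, m x x = 0 := fun x => by
    rw [hmdef, smul_apply, sub_apply, one_apply_self, hf, sub_self, mul_zero]
  refine ⟨seriesEval m hm s, fun x => by rw [seriesEval_apply_self, hs1], ?_⟩
  have := seriesEval_coe hm (1 - Polynomial.C 4 * Polynomial.X)
  have e : ((1 - Polynomial.C 4 * Polynomial.X : Polynomial K) : K⟦X⟧) = 1 - 4 * PowerSeries.X := by
    have : (PowerSeries.C (4 : K) : K⟦X⟧) = 4 := map_ofNat _ 4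
    simp [this]
  rw [← seriesEval_mul, hs, ← e, this, map_sub, map_mul, map_one, Polynomial.aeval_C,
    Polynomial.aeval_X, ← Algebra.smul_def, hmdef, smul_smul, mul_inv_cancel₀ h4, one_smul,
    sub_sub_cancel]

end PowerSeries

/-! ### Uniqueness of square roots, diagonal elements -/

/-- A relation `2 d = a d + d b` with `a`, `b`, `d` of zero diagonal forces `d = 0`. -/
theorem eq_zero_of_two_smul_eq (h2 : (2 : K) ≠ 0) {a b d : FinIncAlg K X} (ha : ∀ x, a x x = 0)
    (hb : ∀ x, b x x = 0) (hd : ∀ x, d x x = 0) (h : (2 : K) • d = a * d + d * b) : d = 0 := by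
  refine ext_apply fun x y _ => ?_
  obtain ⟨S, hS⟩ := exists_endpoints d x y
  -- Induction on the size of a set T containing S ∩ [u, v]. If `d u v ≠ 0`, then u and v lie in S,
  -- and the relation gives a nonzero entry of `d` on a smaller interval missing u or v, so T loses
  -- a point.
  have key : ∀ n, ∀ T : Finset X, T.card = n → ∀ u v, x ≤ u → v ≤ y →
      (∀ z, u ≤ z → z ≤ v → z ∈ S → z ∈ T) → d u v = 0 := by
    classical
    intro n
    induction n using Nat.strong_induction_on with
    | _ n ih =>
      intro T hT u v hu hv hST
      by_contra hne
      have huv := d.le_of_apply_ne_zero hne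
      have hne' : u ≠ v := by
        rintro rfl
        exact hne (hd u)
      obtain ⟨huS, hvS⟩ := hS u v hu hv hne' hne
      have huT := hST u le_rfl huv huS
      have hvT := hST v huv le_rfl hvS
      have hsum : (a * d + d * b) u v ≠ 0 := by
        rw [← h, smul_apply]
        exact mul_ne_zero h2 hne
      rw [add_apply] at hsum
      by_cases h1 : (a * d) u v = 0
      · rw [h1, zero_add] at hsum
        obtain ⟨z, hz1, hz2⟩ := exists_of_mul_apply_ne_zero _ _ hsum
        have hzv : z < v := lt_of_le_of_ne (b.le_of_apply_ne_zero hz2) (by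
          rintro rfl
          exact hz2 (hb z))
        refine hz1 (ih (T.erase v).card ?_ (T.erase v) rfl u z hu (hzv.le.trans hv) ?_)
        · rw [← hT]
          exact Finset.card_erase_lt_of_mem hvT
        · intro w hw1 hw2 hw
          exact Finset.mem_erase.2 ⟨(hw2.trans_lt hzv).ne, hST w hw1 (hw2.trans hzv.le) hw⟩
      · obtain ⟨z, hz1, hz2⟩ := exists_of_mul_apply_ne_zero _ _ h1
        have huz : u < z := lt_of_le_of_ne (a.le_of_apply_ne_zero hz1) (by
          rintro rfl
          exact hz1 (ha u))
        refine hz2 (ih (T.erase u).card ?_ (T.erase u) rfl z v (hu.trans huz.le) hv ?_)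
        · rw [← hT]
          exact Finset.card_erase_lt_of_mem huT
        · intro w hw1 hw2 hw
          exact Finset.mem_erase.2 ⟨(huz.trans_le hw1).ne', hST w (huz.le.trans hw1) hw2 hw⟩
  exact key S.card S rfl x y le_rfl le_rfl fun z _ _ hz => hz

/-- Unipotent square roots are unique in characteristic different from `2`. -/
theorem unipotent_mul_self_inj (h2 : (2 : K) ≠ 0) {r s : FinIncAlg K X} (hr : ∀ x, r x x = 1)
    (hs : ∀ x, s x x = 1) (h : r * r = s * s) : r = s := by
  -- With d = r - s, the equation r² = s² reads 2d = (1 - r)d + d(1 - s).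
  refine sub_eq_zero.1 (eq_zero_of_two_smul_eq h2 (a := 1 - r) (b := 1 - s) ?_ ?_ ?_ ?_)
  · exact fun x => by rw [sub_apply, one_apply_self, hr, sub_self]
  · exact fun x => by rw [sub_apply, one_apply_self, hs, sub_self]
  · exact fun x => by rw [sub_apply, hr, hs, sub_self]
  · simp only [two_smul, sub_mul, mul_sub, one_mul, mul_one, h]
    abel

/-- The diagonal element with prescribed entries. -/
noncomputable def diag (c : X → K) : FinIncAlg K X := by
  classical
  exact ⟨⟨fun u v => if u = v then c u else 0, fun u v h => if_neg fun h' => h h'.le⟩, fun x y => by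
    refine Set.finite_empty.subset ?_
    rintro ⟨u, v⟩ ⟨_, h2, _, h4⟩
    exact h4 (if_neg h2.ne)⟩

open Classical in
theorem diag_apply (c : X → K) (u v : X) :
    (diag c : FinIncAlg K X) u v = if u = v then c u else 0 := rfl

theorem diag_apply_self (c : X → K) (u : X) : (diag c : FinIncAlg K X) u u = c u := by
  rw [diag_apply, if_pos rfl]

theorem diag_mul_diag (c d : X → K) : (diag c * diag d : FinIncAlg K X) = diag (c * d) := by
  refine ext_apply fun x y _ => ?_
  rw [mul_apply_eq_sum _ _ x y {x}, Finset.sum_singleton]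
  · rw [diag_apply_self, diag_apply, diag_apply]
    split_ifs <;> simp
  · intro z h1 _
    rw [diag_apply] at h1
    by_contra h
    exact h1 (if_neg fun h' => h (by simp [h']))

theorem diag_one : (diag 1 : FinIncAlg K X) = 1 := by
  refine ext_apply fun x y _ => ?_
  rw [diag_apply, one_apply, Pi.one_apply]

theorem isUnit_diag {c : X → K} (hc : ∀ x, c x ≠ 0) : IsUnit (diag c : FinIncAlg K X) := by
  refine isUnit_iff_exists.2 ⟨diag c⁻¹, ?_, ?_⟩ <;> rw [diag_mul_diag, ← diag_one] <;>
    congr 1 <;> ext x <;> simp [hc x]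

theorem unit_apply_self_ne_zero (u : (FinIncAlg K X)ˣ) (x : X) : (u : FinIncAlg K X) x x ≠ 0 := by
  intro h
  have := congrArg (fun g : FinIncAlg K X => g x x) u.mul_inv
  simp only [mul_apply_self, one_apply_self, h, zero_mul] at this
  exact zero_ne_one this

theorem isConj_apply_self {f g : FinIncAlg K X} (h : IsConj f g) (x : X) : f x x = g x x := by
  obtain ⟨c, hc⟩ := h
  have := congrArg (fun g : FinIncAlg K X => g x x) hc.eq
  simp only [mul_apply_self] at this
  rw [mul_comm] at this
  exact mul_right_cancel₀ (unit_apply_self_ne_zero c x) this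

end FinIncAlg

/-! ### Automorphisms preserving the diagonals of the `e x` are inner -/

/-- If every set function in a family is a finitely supported measure, and on each set all but
finitely many members of the family vanish, then all but finitely many members are zero. -/
theorem finite_ne_zero_of_finitely_supported {ι α K : Type*} [AddCommMonoid K]
    (μ : ι → Set α → K)
    (hμ : ∀ i, ∃ F : Finset α, ∀ Y : Set α, μ i Y = ∑ w ∈ F, Y.indicator (fun w => μ i {w}) w)
    (hfin : ∀ Y : Set α, {i | μ i Y ≠ 0}.Finite) : {i | ∃ w, μ i {w} ≠ 0}.Finite := by
  classical
  by_contra hinf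
  choose F hF using hμ
  have hFmem : ∀ i w, μ i {w} ≠ 0 → w ∈ F i := by
    intro i w h
    by_contra hw
    refine h ((hF i {w}).trans (Finset.sum_eq_zero fun v hv => ?_))
    refine Set.indicator_of_notMem (fun h' => hw ?_) _
    rw [← Set.mem_singleton_iff.1 h']
    exact hv
  have : Std.Symm (fun i j : ι => ∀ w, μ i {w} = 0 ∨ μ j {w} = 0) := ⟨fun i j h w => (h w).symm⟩
  -- By `hfin` on singletons, a point carries mass for only finitely many members. Infinitely many
  -- nonzero members therefore contain a sequence with pairwise disjoint supports.
  obtain ⟨f, hP, hr⟩ := exists_seq_of_forall_finset_exists' (fun i => ∃ w, μ i {w} ≠ 0)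
    (fun i j => ∀ w, μ i {w} = 0 ∨ μ j {w} = 0) (fun s _ => by
      have hbad : (⋃ w ∈ s.biUnion F, {j | μ j {w} ≠ 0}).Finite :=
        (s.biUnion F).finite_toSet.biUnion fun w _ => hfin {w}
      obtain ⟨j, hj, hj'⟩ := Set.Infinite.exists_notMem_finite hinf hbad
      refine ⟨j, hj, fun i hi w => ?_⟩
      by_contra h
      push Not at h
      refine hj' (Set.mem_biUnion (x := w) ?_ h.2)
      exact Finset.mem_biUnion.2 ⟨i, hi, hFmem i w h.1⟩)
  choose w hw using hP
  have hinj : Function.Injective f := by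
    intro n k h
    by_contra hne
    rcases hr hne (w n) with h' | h'
    · exact hw n h'
    · rw [← h] at h'
      exact hw n h'
  -- Choosing one support point w n per member gives a set, `Set.range w`, that meets the support of
  -- `f n` in w n alone; it has nonzero measure for all n, against `hfin`.
  refine Set.infinite_of_injective_forall_mem hinj (s := {i | μ i (Set.range w) ≠ 0}) ?_
    (hfin (Set.range w))
  intro n
  have : μ (f n) (Set.range w) = μ (f n) {w n} := by
    rw [hF, Finset.sum_eq_single (w n), Set.indicator_of_mem (Set.mem_range_self n)]
    · rintro v - hv
      by_cases hmem : v ∈ Set.range w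
      · obtain ⟨k, rfl⟩ := hmem
        have hkn : n ≠ k := by
          rintro rfl
          exact hv rfl
        rw [Set.indicator_of_mem (Set.mem_range_self k)]
        exact (hr hkn (w k)).resolve_right (hw k)
      · exact Set.indicator_of_notMem hmem _
    · exact fun h => absurd (hFmem _ _ (hw n)) h
  exact fun h => hw n (this.symm.trans h)

/-- Conjugation by a unit as an algebra automorphism. -/
def unitConj (K : Type*) {A : Type*} [Field K] [Ring A] [Algebra K A] (u : Aˣ) : A ≃ₐ[K] A where
  toFun a := u * a * (u⁻¹ : Aˣ)
  invFun a := (u⁻¹ : Aˣ) * a * u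
  left_inv a := by simp [mul_assoc]
  right_inv a := by simp [mul_assoc]
  map_mul' a b := by simp [mul_assoc]
  map_add' a b := by simp [mul_add, add_mul]
  commutes' k := by rw [← Algebra.commutes, mul_assoc, Units.mul_inv, mul_one]

theorem unitConj_apply (K : Type*) {A : Type*} [Field K] [Ring A] [Algebra K A] (u : Aˣ) (a : A) :
    unitConj K u a = u * a * (u⁻¹ : Aˣ) := rfl

namespace FinIncAlg

variable {K X : Type*} [Field K] [PartialOrder X]

theorem single_mul_single {x y z : X} (hxy : x ≤ y) (hyz : y ≤ z) :
    (single x y hxy * single y z hyz : FinIncAlg K X) = single x z (hxy.trans hyz) := by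
  classical
  refine ext_apply fun u v _ => ?_
  rw [mul_apply_eq_sum _ _ u v {y}, Finset.sum_singleton, single_apply, single_apply, single_apply]
  · by_cases h1 : u = x <;> by_cases h2 : v = z <;> simp [h1, h2]
  · intro w h1 _
    rw [single_apply] at h1
    by_contra h
    exact h1 (if_neg fun h' => h (by simp [h'.2]))

theorem single_ne_zero {x y : X} (h : x ≤ y) : (single x y h : FinIncAlg K X) ≠ 0 := by
  intro h0
  have := congrArg (fun g : FinIncAlg K X => g x y) h0
  simp only [single_apply_self, zero_apply] at this
  exact one_ne_zero this

theorem e_mul_single {x y : X} (h : x ≤ y) :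
    (e x * single x y h : FinIncAlg K X) = single x y h := by
  rw [← single_self, single_mul_single]

theorem single_mul_e {x y : X} (h : x ≤ y) :
    (single x y h * e y : FinIncAlg K X) = single x y h := by
  rw [← single_self, single_mul_single]

theorem exists_apply_ne_zero {f : FinIncAlg K X} (hf : f ≠ 0) : ∃ x y, f x y ≠ 0 := by
  by_contra h
  push Not at h
  exact hf (ext_apply fun x y _ => h x y)

/-- The point is that `S` does not depend on `Y`. -/
theorem mul_diagSet_mul_apply (a b : FinIncAlg K X) (p q : X) :
    ∃ S : Finset X, ∀ Y : Set X,
      (a * diagSet Y * b : FinIncAlg K X) p q = ∑ w ∈ S, Y.indicator (fun w => a p w * b w q) w := by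
  classical
  obtain ⟨S, hp, -, ha, -, -⟩ := exists_common₃ a a b p q
  refine ⟨S, fun Y => ?_⟩
  rw [mul_apply_eq_sum _ b p q S]
  · refine Finset.sum_congr rfl fun w _ => ?_
    rw [mul_diagSet_apply, Set.indicator_apply]
    split_ifs
    · rfl
    · rw [zero_mul]
  · intro w h1 h2
    rw [mul_diagSet_apply] at h1
    refine (ha p w le_rfl (b.le_of_apply_ne_zero h2) fun h => h1 ?_).1 hp
    rw [h, ite_self]

/-- The entries of the image of `e_Y` under an automorphism depend on `Y` through a finitely
supported measure. -/
theorem exists_map_diagSet_apply_eq_sum (Ψ : FinIncAlg K X ≃ₐ[K] FinIncAlg K X) (z x : X) :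
    ∃ F : Finset X, ∀ Y : Set X,
      Ψ (diagSet Y) z x = ∑ w ∈ F, Y.indicator (fun w => Ψ (diagSet {w}) z x) w := by
  classical
  by_cases h : z ≤ x
  · have hc0 : Ψ.symm (single z x h) ≠ 0 := by
      rw [Ne, EmbeddingLike.map_eq_zero_iff]
      exact single_ne_zero h
    obtain ⟨p, q, hpq⟩ := exists_apply_ne_zero hc0
    have key : ∀ Y : Set X, Ψ.symm (e z) * diagSet Y * Ψ.symm (e x) =
        Ψ (diagSet Y) z x • Ψ.symm (single z x h) := by
      intro Y
      apply Ψ.injective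
      rw [map_mul, map_mul, map_smul, AlgEquiv.apply_symm_apply, AlgEquiv.apply_symm_apply,
        AlgEquiv.apply_symm_apply, e_mul_mul_e _ _ _ h]
    obtain ⟨S, hS⟩ := mul_diagSet_mul_apply (Ψ.symm (e z)) (Ψ.symm (e x)) p q
    simp only [key, smul_apply] at hS
    refine ⟨S, fun Y => mul_right_cancel₀ hpq ?_⟩
    rw [hS Y, Finset.sum_mul]
    refine Finset.sum_congr rfl fun w hw => ?_
    by_cases hY : w ∈ Y
    · rw [Set.indicator_of_mem hY, Set.indicator_of_mem hY, hS {w}, Finset.sum_eq_single w]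
      · rw [Set.indicator_of_mem (Set.mem_singleton w)]
      · intro v _ hv
        exact Set.indicator_of_notMem (s := {w}) hv _
      · exact fun h => absurd hw h
    · rw [Set.indicator_of_notMem hY, Set.indicator_of_notMem hY, zero_mul]
  · exact ⟨∅, fun Y => by rw [apply_of_not_le _ h, Finset.sum_empty]⟩

/-- An automorphism that preserves the diagonal entries of the idempotents `e_x` moves all of them
by one conjugation. -/
theorem exists_unit_map_e (Ψ : FinIncAlg K X ≃ₐ[K] FinIncAlg K X)
    (hΨ : ∀ x, Ψ (e x) x x = 1) :
    ∃ u : (FinIncAlg K X)ˣ, ∀ x, Ψ (e x) * (u : FinIncAlg K X) = (u : FinIncAlg K X) * e x := by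
  -- U has as column x the column x of Ψ(e_x). Finitarity is the difficulty, as infinitely many
  -- elements contribute; it follows from the finitarity of Ψ(e_Y) for every Y, infinite ones
  -- included, by the lemma on finitely supported measures.
  let U : FinIncAlg K X := ⟨⟨fun z x => Ψ (e x) z x, fun z x h => apply_of_not_le _ h⟩, by
    intro a b
    have hfin := finite_ne_zero_of_finitely_supported
      (ι := {p : X × X // a ≤ p.1 ∧ p.1 < p.2 ∧ p.2 ≤ b})
      (fun p Y => Ψ (diagSet Y) p.1.1 p.1.2)
      (fun p => exists_map_diagSet_apply_eq_sum Ψ p.1.1 p.1.2)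
      (fun Y => by
        refine Set.Finite.of_finite_image (f := Subtype.val) ?_ Subtype.val_injective.injOn
        refine ((Ψ (diagSet Y)).2 a b).subset ?_
        rintro _ ⟨p, hp, rfl⟩
        exact ⟨p.2.1, p.2.2.1, p.2.2.2, hp⟩)
    refine (hfin.image Subtype.val).subset ?_
    rintro p ⟨h1, h2, h3, h4⟩
    exact ⟨⟨p, h1, h2, h3⟩, ⟨p.2, h4⟩, rfl⟩⟩
  have hU : ∀ z x, U z x = Ψ (e x) z x := fun z x => rfl
  have hUe : ∀ x, U * e x = Ψ (e x) * e x := by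
    intro x
    refine ext_apply fun u v _ => ?_
    rw [mul_e_apply, mul_e_apply]
    split_ifs with h
    · rw [hU, h]
    · rfl
  have hunit : IsUnit U := isUnit_of_unipotent fun x => (hU x x).trans (hΨ x)
  refine ⟨hunit.unit, fun x => ?_⟩
  rw [IsUnit.unit_spec]
  refine ext_apply fun u v _ => ?_
  -- Column v of Ψ(e_x)U is that of Ψ(e_x)Ψ(e_v), which vanishes unless x = v.
  have h1 : (Ψ (e x) * U) u v = (Ψ (e x) * U * e v : FinIncAlg K X) u v := by rw [mul_e_apply, if_pos rfl]
  rw [h1, mul_assoc, hUe, ← mul_assoc, ← map_mul, mul_e_apply]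
  by_cases hxv : x = v
  · subst hxv
    rw [e_mul_e_self, mul_e_apply, hU]
  · rw [e_mul_e_of_ne hxv, map_zero, zero_apply, ite_self, mul_e_apply, if_neg (Ne.symm hxv)]

/-- An automorphism that fixes every `e_x` is multiplicative. -/
theorem isMultiplicativeAut_of_map_e (Ψ : FinIncAlg K X ≃ₐ[K] FinIncAlg K X)
    (hΨ : ∀ x, Ψ (e x) = e x) : IsMultiplicativeAut Ψ := by
  classical
  let σ : IncidenceAlgebra K X :=
    ⟨fun x y => if h : x ≤ y then Ψ (single x y h) x y else 0, fun x y h => dif_neg h⟩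
  have hσ : ∀ (x y : X) (h : x ≤ y), σ x y = Ψ (single x y h) x y := fun x y h => dif_pos h
  have hs : ∀ (x y : X) (h : x ≤ y), Ψ (single x y h) = σ x y • single x y h := by
    intro x y h
    conv_lhs => rw [← single_mul_e h, ← e_mul_single h]
    rw [map_mul, map_mul, hΨ, hΨ, e_mul_mul_e, hσ x y h]
  refine ⟨σ, ⟨fun x y h h0 => ?_, fun x y z hxy hyz => ?_⟩, fun f x y => ?_⟩
  · have := hs x y h
    rw [h0, zero_smul, EmbeddingLike.map_eq_zero_iff] at this
    exact single_ne_zero h this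
  · have := hs x z (hxy.trans hyz)
    rw [← single_mul_single hxy hyz, map_mul, hs, hs, smul_mul_smul_comm, single_mul_single] at this
    have := congrArg (fun g : FinIncAlg K X => g x z) this
    simpa only [smul_apply, single_apply_self, mul_one] using this
  · by_cases h : x ≤ y
    · have h1 : (Ψ f) x y = (e x * Ψ f * e y : FinIncAlg K X) x y := by
        rw [mul_e_apply, if_pos rfl, e_mul_apply, if_pos rfl]
      rw [h1, ← hΨ x, ← hΨ y, ← map_mul, ← map_mul, e_mul_mul_e _ _ _ h, map_smul, smul_apply,
        hσ x y h, mul_comm]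
    · rw [apply_of_not_le _ h, apply_of_not_le _ h, mul_zero]

/-- A conjugation makes Ψ fix every `e x`; the result is multiplicative, hence inner by hypothesis.
-/
theorem isInnerAut_of_map_e_apply_self
    (hinner : ∀ Φ : FinIncAlg K X ≃ₐ[K] FinIncAlg K X, IsMultiplicativeAut Φ → IsInnerAut Φ)
    (Ψ : FinIncAlg K X ≃ₐ[K] FinIncAlg K X) (hΨ : ∀ x, Ψ (e x) x x = 1) : IsInnerAut Ψ := by
  obtain ⟨u, hu⟩ := exists_unit_map_e Ψ hΨ
  obtain ⟨w, hw⟩ := hinner (Ψ.trans (unitConj K u⁻¹)) (isMultiplicativeAut_of_map_e _ fun x => by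
    rw [AlgEquiv.trans_apply, unitConj_apply, inv_inv, mul_assoc, hu, Units.inv_mul_cancel_left])
  refine ⟨u * w, fun a => ?_⟩
  have := hw a
  rw [AlgEquiv.trans_apply, unitConj_apply, inv_inv] at this
  have h : Ψ a = u * (((u⁻¹ : (FinIncAlg K X)ˣ) : FinIncAlg K X) * Ψ a * u) *
      ((u⁻¹ : (FinIncAlg K X)ˣ) : FinIncAlg K X) := by
    simp [mul_assoc]
  rw [h, this]
  simp [mul_assoc]

end FinIncAlg

/-! ### Involutions and conjugacy -/

namespace IsAlgInvolution

variable {A : Type*} [Ring A] {ρ : A →+ A}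

theorem map_one (hρ : IsAlgInvolution ρ) : ρ 1 = 1 := by
  have h := hρ.map_mul_rev 1 (ρ 1)
  rw [one_mul, hρ.apply_apply, one_mul] at h
  exact h.symm

/-- The image of a unit under an involution. -/
def mapUnit (hρ : IsAlgInvolution ρ) (u : Aˣ) : Aˣ where
  val := ρ u
  inv := ρ (u⁻¹ : Aˣ)
  val_inv := by rw [← hρ.map_mul_rev, Units.inv_mul, hρ.map_one]
  inv_val := by rw [← hρ.map_mul_rev, Units.mul_inv, hρ.map_one]

theorem isConj_map (hρ : IsAlgInvolution ρ) {a b : A} (h : IsConj a b) : IsConj (ρ a) (ρ b) := by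
  obtain ⟨c, hc⟩ := h
  refine IsConj.symm ⟨hρ.mapUnit c, ?_⟩
  change ρ c * ρ b = ρ a * ρ c
  rw [← hρ.map_mul_rev, ← hρ.map_mul_rev, hc.eq]

end IsAlgInvolution

/-! ### Idempotents up to conjugacy and the induced poset automorphism -/

namespace FinIncAlg

variable {K X : Type*} [Field K] [PartialOrder X]

theorem e_ne_zero (x : X) : (e x : FinIncAlg K X) ≠ 0 := by
  rw [← single_self]
  exact single_ne_zero _

theorem eq_of_isConj_e {x y : X} (h : IsConj (e x : FinIncAlg K X) (e y)) : x = y := by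
  have := isConj_apply_self h x
  rw [e_apply_self, e_apply] at this
  by_contra hne
  rw [if_neg fun h' => hne h'.2] at this
  exact one_ne_zero this

theorem Induces.isConj {ρ : FinIncAlg K X →+ FinIncAlg K X} {l : X → X} (h : Induces ρ l) (x : X) :
    IsConj (e (l x)) (ρ (e x)) := by
  obtain ⟨u, hu⟩ := h x
  refine ⟨u, ?_⟩
  rw [SemiconjBy, hu, Units.inv_mul_cancel_right]

/-- Every idempotent is conjugate to its diagonal. -/
theorem exists_isConj_diagSet (f : FinIncAlg K X) (hf : f * f = f) :
    ∃ Y : Set X, IsConj (diagSet Y) f := by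
  classical
  have hd : ∀ x, f x x = 0 ∨ f x x = 1 := by
    intro x
    have := congrArg (fun g : FinIncAlg K X => g x x) hf
    simp only [mul_apply_self] at this
    exact IsIdempotentElem.iff_eq_zero_or_one.1 this
  set d : FinIncAlg K X := diagSet {x | f x x = 1} with hddef
  have hdd : d * d = d := by rw [hddef, diagSet_mul_diagSet, Set.inter_self]
  -- This element intertwines d and f, and is unipotent because both have the same 0-1 diagonal.
  have hu : IsUnit (f * d + (1 - f) * (1 - d)) := by
    refine isUnit_of_unipotent fun x => ?_
    rw [add_apply, mul_apply_self, mul_apply_self, sub_apply, sub_apply, one_apply_self, hddef,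
      diagSet_apply]
    rcases hd x with h | h <;> simp [h]
  refine ⟨{x | f x x = 1}, hu.unit, ?_⟩
  rw [SemiconjBy, IsUnit.unit_spec, ← hddef]
  have h1 : (1 - d) * d = 0 := by rw [sub_mul, one_mul, hdd, sub_self]
  have h2 : f * (1 - f) = 0 := by rw [mul_sub, mul_one, hf, sub_self]
  rw [add_mul, mul_add, mul_assoc, mul_assoc, hdd, h1, mul_zero, add_zero, ← mul_assoc f,
    ← mul_assoc f, hf, h2, zero_mul, add_zero]

/-- Automorphisms permute the conjugacy classes of the idempotents `e_x`. -/
theorem exists_isConj_map_e (Φ : FinIncAlg K X ≃ₐ[K] FinIncAlg K X) (x : X) :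
    ∃ y, IsConj (e y) (Φ (e x)) := by
  obtain ⟨Y, c, hc⟩ := exists_isConj_diagSet (Φ (e x)) (by rw [← map_mul, e_mul_e_self])
  have hcx : Φ (e x) = c.val * diagSet Y * c⁻¹.val := by
    rw [hc.eq, Units.mul_inv_cancel_right]
  have hY : Y.Nonempty := by
    rw [Set.nonempty_iff_ne_empty]
    rintro rfl
    have h0 : (diagSet ∅ : FinIncAlg K X) = 0 := by
      classical
      refine ext_apply fun u v _ => ?_
      rw [diagSet_apply, if_neg fun h => h.2]
      rfl
    rw [h0, mul_zero, zero_mul, EmbeddingLike.map_eq_zero_iff] at hcx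
    exact e_ne_zero x hcx
  obtain ⟨y, hy⟩ := hY
  have hyY : ({y} : Set X) ⊆ Y := Set.singleton_subset_iff.2 hy
  have h1 : (diagSet Y * e y : FinIncAlg K X) = e y := by
    rw [e, diagSet_mul_diagSet, Set.inter_eq_self_of_subset_right hyY]
  have h2 : (e y * diagSet Y : FinIncAlg K X) = e y := by
    rw [e, diagSet_mul_diagSet, Set.inter_eq_self_of_subset_left hyY]
  set h : FinIncAlg K X := c.val * e y * c⁻¹.val with hdef
  have h3 : Φ (e x) * h = h := by
    rw [hcx, hdef]
    simp only [mul_assoc, Units.inv_mul_cancel_left]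
    rw [← mul_assoc (diagSet Y), h1]
  have h4 : h * Φ (e x) = h := by
    rw [hcx, hdef]
    simp only [mul_assoc, Units.inv_mul_cancel_left]
    rw [← mul_assoc (e y), h2]
  have h5 : h * h = h := by
    rw [hdef]
    simp only [mul_assoc, Units.inv_mul_cancel_left]
    rw [← mul_assoc (e y), e_mul_e_self]
  have h6 : h ≠ 0 := by
    intro h0
    refine e_ne_zero (K := K) y ?_
    have : e y = c⁻¹.val * h * c.val := by
      rw [hdef]
      simp [mul_assoc]
    rw [this, h0, mul_zero, zero_mul]
  -- h is a nonzero idempotent below Φ(e_x), so g is one below e_x; minimality of e_x forces g =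
  -- e_x.
  set g := Φ.symm h with hg
  have hΦg : Φ g = h := Φ.apply_symm_apply h
  have hgx : g = g x x • e x := by
    rw [← e_mul_mul_e_self]
    apply Φ.injective
    rw [map_mul, map_mul, hΦg, h3, h4]
  have hg1 : g x x = 1 := by
    have hgg : g * g = g := by
      apply Φ.injective
      rw [map_mul, hΦg, h5]
    have := congrArg (fun g : FinIncAlg K X => g x x) hgg
    simp only [mul_apply_self] at this
    refine (IsIdempotentElem.iff_eq_zero_or_one.1 this).resolve_left fun h0 => h6 ?_
    rw [← hΦg, hgx, h0, zero_smul, map_zero]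
  rw [hg1, one_smul] at hgx
  refine ⟨y, c, ?_⟩
  rw [SemiconjBy, ← hgx, hΦg, hdef, Units.inv_mul_cancel_right]

/-- The order is visible in the algebra: e_y A e_y' ≠ 0 requires y ≤ y', and this nonvanishing
survives automorphisms and conjugating either idempotent. -/
theorem le_of_isConj_map_e (Φ : FinIncAlg K X ≃ₐ[K] FinIncAlg K X) {x x' y y' : X}
    (h : IsConj (e y) (Φ (e x))) (h' : IsConj (e y') (Φ (e x'))) (hx : x ≤ x') : y ≤ y' := by
  classical
  obtain ⟨c, hc⟩ := h
  obtain ⟨d, hd⟩ := h'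
  have h1 : Φ (e x) * Φ (single x x' hx) * Φ (e x') ≠ 0 := by
    rw [← map_mul, ← map_mul, e_mul_single, single_mul_e, Ne, EmbeddingLike.map_eq_zero_iff]
    exact single_ne_zero hx
  by_contra hne
  have h2 : ∀ g : FinIncAlg K X, e y * g * e y' = 0 := by
    intro g
    refine ext_apply fun u v _ => ?_
    rw [mul_e_apply, e_mul_apply, zero_apply]
    split_ifs with hv hu
    · rw [hu, hv, apply_of_not_le _ hne]
    · rfl
    · rfl
  refine h1 ?_
  have hcx : Φ (e x) = c.val * e y * c⁻¹.val := by
    rw [hc.eq, Units.mul_inv_cancel_right]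
  have hdx : Φ (e x') = d.val * e y' * d⁻¹.val := by
    rw [hd.eq, Units.mul_inv_cancel_right]
  have h3 := h2 (c⁻¹.val * Φ (single x x' hx) * d.val)
  calc Φ (e x) * Φ (single x x' hx) * Φ (e x') =
      c.val * (e y * (c⁻¹.val * Φ (single x x' hx) * d.val) * e y') *
        d⁻¹.val := by
        rw [hcx, hdx]
        simp only [mul_assoc]
    _ = 0 := by rw [h3, mul_zero, zero_mul]

/-- Every automorphism induces an automorphism of the poset. -/
theorem exists_orderIso_isConj_map_e (Φ : FinIncAlg K X ≃ₐ[K] FinIncAlg K X) :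
    ∃ α : X ≃o X, ∀ x, IsConj (e (α x)) (Φ (e x)) := by
  choose α hα using exists_isConj_map_e Φ
  choose β hβ using exists_isConj_map_e Φ.symm
  have hleft : ∀ x, β (α x) = x := fun x => eq_of_isConj_e (K := K) <| by
    have := (Φ.symm : FinIncAlg K X →* FinIncAlg K X).map_isConj (hα x)
    simp only [MonoidHom.coe_coe, AlgEquiv.symm_apply_apply] at this
    exact (hβ (α x)).trans this
  have hright : ∀ x, α (β x) = x := fun x => eq_of_isConj_e (K := K) <| by
    have := (Φ : FinIncAlg K X →* FinIncAlg K X).map_isConj (hβ x)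
    simp only [MonoidHom.coe_coe, AlgEquiv.apply_symm_apply] at this
    exact (hα (β x)).trans this
  refine ⟨⟨⟨α, β, hleft, hright⟩, fun {x y} => ⟨fun h => ?_, fun h => ?_⟩⟩, hα⟩
  · rw [← hleft x, ← hleft y]
    exact le_of_isConj_map_e Φ.symm (hβ _) (hβ _) h
  · exact le_of_isConj_map_e Φ (hα _) (hα _) h

/-! ### Action on scalars and necessity of the conditions -/

theorem algebraMap_injective [Nonempty X] :
    Function.Injective (algebraMap K (FinIncAlg K X)) := by
  intro a b h
  obtain ⟨x⟩ := ‹Nonempty X›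
  rw [← algebraMap_apply_self a x, h, algebraMap_apply_self]

/-- An involution acts on the scalars by a ring endomorphism. -/
theorem exists_ringHom_map_algebraMap (hX : IsConnectedPoset X) [Nonempty X]
    {ρ : FinIncAlg K X →+ FinIncAlg K X} (hρ : IsAlgInvolution ρ) :
    ∃ τ : K →+* K, ∀ k, ρ (algebraMap K (FinIncAlg K X) k) = algebraMap K (FinIncAlg K X) (τ k) := by
  obtain ⟨x₀⟩ := ‹Nonempty X›
  -- An anti-automorphism preserves the center, which is K.
  have key : ∀ k, ρ (algebraMap K (FinIncAlg K X) k) =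
      algebraMap K (FinIncAlg K X) (ρ (algebraMap K (FinIncAlg K X) k) x₀ x₀) := by
    intro k
    refine eq_algebraMap_of_commute hX _ (fun g => ?_) x₀
    rw [← hρ.apply_apply g, ← hρ.map_mul_rev, ← hρ.map_mul_rev, Algebra.commutes]
  refine ⟨⟨⟨⟨fun k => ρ (algebraMap K (FinIncAlg K X) k) x₀ x₀, ?_⟩, ?_⟩, ?_, ?_⟩, key⟩
  · rw [map_one, hρ.map_one, one_apply_self]
  · intro a b
    change ρ (algebraMap K (FinIncAlg K X) (a * b)) x₀ x₀ = _
    rw [map_mul, hρ.map_mul_rev, mul_apply_self, mul_comm]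
  · simp only [map_zero, zero_apply]
  · intro a b
    simp only [map_add, add_apply]

/-- For the α induced by Φ, the idempotents at α(l₁ x) and l₂(α x) are both conjugate to Φ(ρ₁(e_x))
= ρ₂(Φ(e_x)). -/
theorem posetInvolutionsEquivalent_and_agreeOnScalars (hX : IsConnectedPoset X) {l₁ l₂ : X → X}
    {ρ₁ ρ₂ : FinIncAlg K X →+ FinIncAlg K X} (hρ₁ : IsAlgInvolution ρ₁) (hρ₂ : IsAlgInvolution ρ₂)
    (hind₁ : Induces ρ₁ l₁) (hind₂ : Induces ρ₂ l₂) (h : InvolutionsEquivalent K ρ₁ ρ₂) :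
    PosetInvolutionsEquivalent l₁ l₂ ∧ AgreeOnScalars K ρ₁ ρ₂ := by
  obtain ⟨Φ, hΦ⟩ := h
  constructor
  · obtain ⟨α, hα⟩ := exists_orderIso_isConj_map_e Φ
    refine ⟨α, fun x => eq_of_isConj_e (K := K) ?_⟩
    have h1 : IsConj (e (α (l₁ x))) (Φ (ρ₁ (e x))) :=
      (hα (l₁ x)).trans ((Φ : FinIncAlg K X →* FinIncAlg K X).map_isConj (hind₁.isConj x))
    have h2 : IsConj (e (l₂ (α x))) (ρ₂ (Φ (e x))) :=
      (hind₂.isConj (α x)).trans (hρ₂.isConj_map (hα x))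
    rw [hΦ] at h1
    exact h1.trans h2.symm
  · intro k
    rcases isEmpty_or_nonempty X with hX' | hX'
    · exact ext_apply fun x => isEmptyElim x
    · obtain ⟨τ, hτ⟩ := exists_ringHom_map_algebraMap hX hρ₁
      have := hΦ (algebraMap K (FinIncAlg K X) k)
      rw [hτ, AlgEquiv.commutes, AlgEquiv.commutes] at this
      rw [hτ, this]

end FinIncAlg

/-! ### Involutions inducing the same map on the poset -/

/-- Hilbert's theorem 90 for an involution of a field. -/
theorem exists_ne_zero_mul_map_eq {K : Type*} [Field K] (τ : K →+* K) (hττ : ∀ k, τ (τ k) = k)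
    (hτ : ∃ k, τ k ≠ k) {k : K} (hk : k * τ k = 1) : ∃ c ≠ 0, k * τ c = c := by
  have key : ∀ b, k * τ (b + k * τ b) = b + k * τ b := by
    intro b
    rw [map_add, map_mul, hττ]
    linear_combination b * hk
  -- If all the solutions b + kτ(b) vanish, then b = 1 gives k = -1, and so τ = id.
  by_contra! h
  have hz : ∀ b, b + k * τ b = 0 := fun b => by
    by_contra hb
    exact h _ hb (key b)
  have hk1 : k = -1 := by
    have := hz 1
    rw [map_one, mul_one] at this
    linear_combination this
  obtain ⟨b, hb⟩ := hτ
  apply hb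
  have := hz b
  rw [hk1] at this
  linear_combination -this

namespace FinIncAlg

variable {K X : Type*} [Field K] [PartialOrder X]

section Semilinear

variable {ρ : FinIncAlg K X →+ FinIncAlg K X} {τ : K →+* K}

theorem map_smul_of_map_algebraMap (hρ : IsAlgInvolution ρ)
    (hτ : ∀ k, ρ (algebraMap K (FinIncAlg K X) k) = algebraMap K (FinIncAlg K X) (τ k))
    (k : K) (f : FinIncAlg K X) : ρ (k • f) = τ k • ρ f := by
  rw [Algebra.smul_def, hρ.map_mul_rev, hτ, ← Algebra.commutes, ← Algebra.smul_def]

/-- The action on diagonal entries of an involution that induces `l` on the poset. -/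
theorem map_apply_self (hρ : IsAlgInvolution ρ)
    (hτ : ∀ k, ρ (algebraMap K (FinIncAlg K X) k) = algebraMap K (FinIncAlg K X) (τ k))
    {l : X → X} (hind : Induces ρ l) (f : FinIncAlg K X) (x : X) :
    ρ f (l x) (l x) = τ (f x x) := by
  have h1 : ρ (e x) (l x) (l x) = 1 := by
    rw [← isConj_apply_self (hind.isConj x), e_apply_self]
  -- Applying ρ to e_x f e_x = f(x, x) e_x and reading the entry at l x isolates the value.
  have h2 := congrArg ρ (e_mul_mul_e_self f x)
  rw [map_smul_of_map_algebraMap hρ hτ, hρ.map_mul_rev, hρ.map_mul_rev] at h2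
  have h3 := congrArg (fun g : FinIncAlg K X => g (l x) (l x)) h2
  simpa only [mul_apply_self, smul_apply, h1, one_mul, mul_one] using h3

end Semilinear

/-- Two involutions that induce the same map on the poset and agree on scalars differ by an inner
automorphism given by a unit fixed by the first one. -/
theorem exists_unit_intertwine (hX : IsConnectedPoset X) [Nonempty X]
    (hinner : ∀ Φ : FinIncAlg K X ≃ₐ[K] FinIncAlg K X, IsMultiplicativeAut Φ → IsInnerAut Φ)
    {l : X → X} (hl : ∀ x, l (l x) = x) {ρ₁ ρ₂ : FinIncAlg K X →+ FinIncAlg K X}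
    (hρ₁ : IsAlgInvolution ρ₁) (hρ₂ : IsAlgInvolution ρ₂)
    (hind₁ : Induces ρ₁ l) (hind₂ : Induces ρ₂ l) {τ : K →+* K}
    (hτ₁ : ∀ k, ρ₁ (algebraMap K (FinIncAlg K X) k) = algebraMap K (FinIncAlg K X) (τ k))
    (hτ₂ : ∀ k, ρ₂ (algebraMap K (FinIncAlg K X) k) = algebraMap K (FinIncAlg K X) (τ k))
    (hττ : ∀ k, τ (τ k) = k) (hτ : ∃ k, τ k ≠ k) :
    ∃ v : (FinIncAlg K X)ˣ, ρ₁ v = v ∧ ∀ a, ρ₂ a * v = v.val * ρ₁ a := by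
  obtain ⟨x₀⟩ := ‹Nonempty X›
  let Ψ : FinIncAlg K X ≃ₐ[K] FinIncAlg K X :=
    { toFun := fun a => ρ₂ (ρ₁ a)
      invFun := fun a => ρ₁ (ρ₂ a)
      left_inv := fun a => by
        change ρ₁ (ρ₂ (ρ₂ (ρ₁ a))) = a
        rw [hρ₂.apply_apply, hρ₁.apply_apply]
      right_inv := fun a => by
        change ρ₂ (ρ₁ (ρ₁ (ρ₂ a))) = a
        rw [hρ₁.apply_apply, hρ₂.apply_apply]
      map_mul' := fun a b => by rw [hρ₁.map_mul_rev, hρ₂.map_mul_rev]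
      map_add' := fun a b => by rw [map_add, map_add]
      commutes' := fun k => by rw [hτ₁, hτ₂, hττ] }
  have hΨ : ∀ x, Ψ (e x) x x = 1 := by
    intro x
    change ρ₂ (ρ₁ (e x)) x x = 1
    have h1 := map_apply_self hρ₂ hτ₂ hind₂ (ρ₁ (e x)) (l x)
    rw [hl, map_apply_self hρ₁ hτ₁ hind₁, hττ, e_apply_self] at h1
    exact h1
  obtain ⟨v, hv⟩ := isInnerAut_of_map_e_apply_self hinner Ψ hΨ
  have hv' : ∀ a, ρ₂ a = v.val * ρ₁ a * v⁻¹.val := by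
    intro a
    have := hv (ρ₁ a)
    rw [← this]
    change ρ₂ a = ρ₂ (ρ₁ (ρ₁ a))
    rw [hρ₁.apply_apply]
  have hv2 : ∀ a, ρ₂ a * v = v.val * ρ₁ a := fun a => by rw [hv', Units.inv_mul_cancel_right]
  -- Expanding ρ₂² = id through v shows that ρ₁(v)v⁻¹ is central, hence a scalar k.
  have hcomm : ∀ a, ρ₁ v * v⁻¹.val * a = a * (ρ₁ v * v⁻¹.val) := by
    intro a
    have h1 : a = v.val * (ρ₁ v⁻¹.val * a * ρ₁ v) * v⁻¹.val := by
      conv_lhs => rw [← hρ₂.apply_apply a, hv' (ρ₂ a), hv' a, hρ₁.map_mul_rev, hρ₁.map_mul_rev,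
        hρ₁.apply_apply, ← mul_assoc (ρ₁ v⁻¹.val)]
    have h2 : ρ₁ v * ρ₁ v⁻¹.val = 1 := by
      rw [← hρ₁.map_mul_rev, Units.inv_mul, hρ₁.map_one]
    conv_lhs => rw [h1]
    rw [mul_assoc (ρ₁ v), mul_assoc v.val, Units.inv_mul_cancel_left, ← mul_assoc,
      mul_assoc (ρ₁ v⁻¹.val), ← mul_assoc (ρ₁ v), h2, one_mul, mul_assoc]
  set k := (ρ₁ v * v⁻¹.val : FinIncAlg K X) x₀ x₀
  have hk : ρ₁ v = k • v.val := by
    have := eq_algebraMap_of_commute hX _ hcomm x₀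
    rw [Algebra.smul_def, ← this, Units.inv_mul_cancel_right]
  have hkk : k * τ k = 1 := by
    have h1 := hρ₁.apply_apply v
    rw [hk, map_smul_of_map_algebraMap hρ₁ hτ₁, hk, smul_smul] at h1
    have h2 := congrArg (fun g : FinIncAlg K X => g x₀ x₀) h1
    simp only [smul_apply] at h2
    rw [mul_comm k]
    exact mul_right_cancel₀ (unit_apply_self_ne_zero v x₀) (h2.trans (one_mul _).symm)
  obtain ⟨c, hc0, hc⟩ := exists_ne_zero_mul_map_eq τ hττ hτ hkk
  refine ⟨Units.mk0 c hc0 • v, ?_, fun a => ?_⟩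
  · rw [Units.val_smul, Units.smul_mk0, map_smul_of_map_algebraMap hρ₁ hτ₁, hk, smul_smul,
      mul_comm, hc]
  · rw [Units.val_smul, Units.smul_mk0, mul_smul_comm, smul_mul_assoc, hv2]

/-- A unit fixed by `ρ` is of the form `s w ρ(w)` with a nonzero scalar `s`. -/
theorem exists_eq_smul_mul_map (h2 : (2 : K) ≠ 0) {l : X → X} (hl : ∀ x, l (l x) = x)
    (hfix : (Function.fixedPoints l).Subsingleton) {ρ : FinIncAlg K X →+ FinIncAlg K X}
    (hρ : IsAlgInvolution ρ) (hind : Induces ρ l) {τ : K →+* K}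
    (hτ : ∀ k, ρ (algebraMap K (FinIncAlg K X) k) = algebraMap K (FinIncAlg K X) (τ k))
    (v : (FinIncAlg K X)ˣ) (hv : ρ v = v) :
    ∃ (s : K) (w : (FinIncAlg K X)ˣ), s ≠ 0 ∧ v.val = s • (w.val * ρ w) := by
  classical
  have hdiag := map_apply_self hρ hτ hind
  have hdiag' : ∀ f : FinIncAlg K X, ∀ x, ρ f x x = τ (f (l x) (l x)) := by
    intro f x
    have := hdiag f (l x)
    rwa [hl] at this
  -- At a fixed point the diagonal entry of wρ(w) is a norm cτ(c), which that of v need not be; s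
  -- removes this obstruction, and one scalar suffices for at most one fixed point. Without fixed
  -- points s = 1 will do.
  obtain ⟨s, hs0, hτs, hs⟩ : ∃ s : K, s ≠ 0 ∧ τ s = s ∧ ∀ x, l x = x → v.val x x = s := by
    by_cases h : ∃ x₀, l x₀ = x₀
    · obtain ⟨x₀, hx₀⟩ := h
      refine ⟨v.val x₀ x₀, unit_apply_self_ne_zero v x₀, ?_, fun x hx => by rw [hfix hx hx₀]⟩
      have := hdiag v.val x₀
      rw [hv, hx₀] at this
      exact this.symm
    · exact ⟨1, one_ne_zero, map_one τ, fun x hx => absurd ⟨x, hx⟩ h⟩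
  set v' : FinIncAlg K X := s⁻¹ • v.val with hv'def
  have hv' : ρ v' = v' := by
    rw [hv'def, map_smul_of_map_algebraMap hρ hτ, hv, map_inv₀, hτs]
  have hv'x : ∀ x, v' x x ≠ 0 := fun x =>
    mul_ne_zero (inv_ne_zero hs0) (unit_apply_self_ne_zero v x)
  have hv'fix : ∀ x, l x = x → v' x x = 1 := fun x hx => by
    rw [hv'def, smul_apply, hs x hx, inv_mul_cancel₀ hs0]
  -- A well-order selects one point of each orbit {x, l x}; w₀ carries v' there and 1 elsewhere, so
  -- w₀ρ(w₀) has the diagonal of v'.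
  obtain ⟨w₀, hw₀⟩ := isUnit_diag (K := K)
    (c := fun x => if WellOrderingRel x (l x) then v' x x else 1) (fun x => by
      split_ifs
      · exact hv'x x
      · exact one_ne_zero)
  have hw₀x : ∀ x, w₀.val x x = if WellOrderingRel x (l x) then v' x x else 1 := fun x => by
    rw [hw₀, diag_apply_self]
  have hprod : ∀ x, w₀.val x x * ρ w₀ x x = v' x x := by
    intro x
    rw [hdiag', hw₀x, hw₀x, hl]
    by_cases h1 : WellOrderingRel x (l x)
    · rw [if_pos h1, if_neg (asymm h1), map_one, mul_one]
    · by_cases h3 : WellOrderingRel (l x) x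
      · rw [if_neg h1, if_pos h3, one_mul, ← hdiag', hv']
      · rw [if_neg h1, if_neg h3, map_one, mul_one, hv'fix]
        exact (Std.Trichotomous.trichotomous x (l x) h1 h3).symm
  set t : FinIncAlg K X := w₀⁻¹.val * v' * ρ w₀⁻¹.val with htdef
  have htv : w₀.val * t * ρ w₀ = v' := by
    have h1 : ρ w₀⁻¹.val * ρ w₀ = 1 := by rw [← hρ.map_mul_rev, Units.mul_inv, hρ.map_one]
    rw [htdef, mul_assoc, mul_assoc, h1, mul_one, Units.mul_inv_cancel_left]
  have hρt : ρ t = t := by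
    rw [htdef, hρ.map_mul_rev, hρ.map_mul_rev, hρ.apply_apply, hv', mul_assoc]
  have ht1 : ∀ x, t x x = 1 := by
    intro x
    have := congrArg (fun g : FinIncAlg K X => g x x) htv
    simp only [mul_apply_self] at this
    have h3 := hprod x
    have h4 : w₀.val x x * ρ w₀ x x ≠ 0 := by
      rw [h3]
      exact hv'x x
    refine mul_right_cancel₀ h4 ?_
    linear_combination this - h3
  obtain ⟨r, hr1, hrr⟩ := exists_unipotent_mul_self_eq h2 ht1
  -- ρ(r) is again a unipotent square root of ρ(t) = t.
  have hρr : ρ r = r := by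
    refine unipotent_mul_self_inj h2 (fun x => ?_) hr1 ?_
    · rw [hdiag', hr1, map_one]
    · rw [← hρ.map_mul_rev, hrr, hρt]
  refine ⟨s, w₀ * (isUnit_of_unipotent hr1).unit, hs0, ?_⟩
  rw [Units.val_mul, IsUnit.unit_spec, hρ.map_mul_rev, hρr]
  have h5 : w₀.val * r * (r * ρ w₀) = v' := by
    rw [← htv, ← hrr]
    simp only [mul_assoc]
  rw [h5, hv'def, smul_smul, mul_inv_cancel₀ hs0, one_smul]

/-- Involutions of the second kind that induce the same map on the poset and agree on scalars are
equivalent. -/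
theorem involutionsEquivalent_of_induces_same (h2 : (2 : K) ≠ 0) (hX : IsConnectedPoset X)
    (hinner : ∀ Φ : FinIncAlg K X ≃ₐ[K] FinIncAlg K X, IsMultiplicativeAut Φ → IsInnerAut Φ)
    {l : X → X} (hl : ∀ x, l (l x) = x) (hfix : (Function.fixedPoints l).Subsingleton)
    {ρ₁ ρ₂ : FinIncAlg K X →+ FinIncAlg K X} (hρ₁ : IsAlgInvolution ρ₁)
    (hρ₂ : IsSecondKindInvolution ρ₂) (hind₁ : Induces ρ₁ l) (hind₂ : Induces ρ₂ l)
    (hagree : AgreeOnScalars K ρ₁ ρ₂) : InvolutionsEquivalent K ρ₁ ρ₂ := by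
  have hne : Nonempty X := by
    by_contra h
    rw [not_nonempty_iff] at h
    exact hρ₂.not_fix_center fun a _ => ext_apply fun x => isEmptyElim x
  obtain ⟨x₀⟩ := hne
  have : Nonempty X := ⟨x₀⟩
  obtain ⟨τ, hτ₂⟩ := exists_ringHom_map_algebraMap hX hρ₂.toIsAlgInvolution
  have hτ₁ : ∀ k, ρ₁ (algebraMap K (FinIncAlg K X) k) = algebraMap K (FinIncAlg K X) (τ k) :=
    fun k => (hagree k).trans (hτ₂ k)
  have hττ : ∀ k, τ (τ k) = k := fun k => algebraMap_injective (X := X) <| by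
    rw [← hτ₂, ← hτ₂, hρ₂.apply_apply]
  -- Being of the second kind means τ ≠ id, because the center is K.
  have hτ : ∃ k, τ k ≠ k := by
    by_contra! h
    refine hρ₂.not_fix_center fun a ha => ?_
    have ha' := eq_algebraMap_of_commute hX a
      (fun g => (Subring.mem_center_iff.1 ha g).symm) x₀
    rw [ha', hτ₂, h]
  obtain ⟨v, hv, hvint⟩ := exists_unit_intertwine hX hinner hl hρ₁ hρ₂.toIsAlgInvolution hind₁
    hind₂ hτ₁ hτ₂ hττ hτ
  obtain ⟨s, w, hs, hw⟩ := exists_eq_smul_mul_map h2 hl hfix hρ₁ hind₁ hτ₁ v hv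
  -- Both sides times v become s·wρ₁(a)ρ₁(w), since v = s·wρ₁(w).
  refine ⟨unitConj K w, fun a => v.isUnit.mul_left_injective ?_⟩
  have h1 : ρ₁ w⁻¹.val * ρ₁ w = 1 := by rw [← hρ₁.map_mul_rev, Units.mul_inv, hρ₁.map_one]
  have h3 : ρ₁ w * ρ₁ w⁻¹.val = 1 := by rw [← hρ₁.map_mul_rev, Units.inv_mul, hρ₁.map_one]
  change unitConj K w (ρ₁ a) * v.val = ρ₂ (unitConj K w a) * v.val
  rw [hvint, unitConj_apply, unitConj_apply, hw, hρ₁.map_mul_rev, hρ₁.map_mul_rev, mul_smul_comm,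
    smul_mul_assoc, mul_assoc (w.val * ρ₁ a), Units.inv_mul_cancel_left, mul_assoc w.val (ρ₁ w),
    ← mul_assoc (ρ₁ w), h3, one_mul, mul_assoc]

/-! ### Relabelling the poset and the main theorem -/

/-- The automorphism of the algebra given by an automorphism of the poset. -/
noncomputable def relabel (α : X ≃o X) : FinIncAlg K X ≃ₐ[K] FinIncAlg K X :=
  let F : (X ≃o X) → FinIncAlg K X → FinIncAlg K X := fun β f =>
    ⟨⟨fun x y => f (β x) (β y), fun x y h =>
      f.apply_of_not_le fun h' => h (β.le_iff_le.1 h')⟩, fun x y => by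
      refine Set.Finite.of_finite_image (f := Prod.map β β) ?_
        (β.injective.prodMap β.injective).injOn
      refine (f.2 (β x) (β y)).subset ?_
      rintro _ ⟨p, ⟨h1, h2, h3, h4⟩, rfl⟩
      exact ⟨β.monotone h1, β.strictMono h2, β.monotone h3, h4⟩⟩
  { toFun := F α.symm
    invFun := F α
    left_inv := fun f => ext_apply fun x y _ => by
      change f (α.symm (α x)) (α.symm (α y)) = f x y
      rw [α.symm_apply_apply, α.symm_apply_apply]
    right_inv := fun f => ext_apply fun x y _ => by
      change f (α (α.symm x)) (α (α.symm y)) = f x y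
      rw [α.apply_symm_apply, α.apply_symm_apply]
    map_add' := fun f g => rfl
    map_mul' := fun f g => ext_apply fun x y _ => by
      change (f * g) (α.symm x) (α.symm y) = (F α.symm f * F α.symm g) x y
      rw [mul_apply, mul_apply]
      refine (finsum_mem_eq_of_bijOn α.symm ⟨?_, α.symm.injective.injOn, ?_⟩ fun z _ => rfl).symm
      · exact fun z hz => ⟨α.symm.monotone hz.1, α.symm.monotone hz.2⟩
      · intro z hz
        exact ⟨α z, ⟨α.symm_apply_le.1 hz.1, α.le_symm_apply.1 hz.2⟩, α.symm_apply_apply z⟩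
    commutes' := fun k => ext_apply fun x y _ => by
      classical
      change (algebraMap K (FinIncAlg K X) k) (α.symm x) (α.symm y) = _
      rw [Algebra.algebraMap_eq_smul_one, smul_apply, smul_apply, one_apply, one_apply]
      simp only [EmbeddingLike.apply_eq_iff_eq] }

theorem relabel_e (α : X ≃o X) (x : X) : relabel α (e x : FinIncAlg K X) = e (α x) := by
  classical
  refine ext_apply fun u v _ => ?_
  change (e x : FinIncAlg K X) (α.symm u) (α.symm v) = _
  rw [e_apply, e_apply]
  simp only [α.symm_apply_eq, α.apply_symm_apply]

/-- Transporting ρ₁ along the relabelling by α gives an involution that induces α l₁ α⁻¹ = l₂ and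
acts on K as before, which reduces to a common map on the poset. -/
theorem involutionsEquivalent_of_posetInvolutionsEquivalent (h2 : (2 : K) ≠ 0)
    (hX : IsConnectedPoset X)
    (hinner : ∀ Φ : FinIncAlg K X ≃ₐ[K] FinIncAlg K X, IsMultiplicativeAut Φ → IsInnerAut Φ)
    {l₁ l₂ : X → X} (hl₂ : ∀ x, l₂ (l₂ x) = x) (hfix₂ : (Function.fixedPoints l₂).Subsingleton)
    {ρ₁ ρ₂ : FinIncAlg K X →+ FinIncAlg K X} (hρ₁ : IsAlgInvolution ρ₁)
    (hρ₂ : IsSecondKindInvolution ρ₂) (hind₁ : Induces ρ₁ l₁) (hind₂ : Induces ρ₂ l₂)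
    (hposet : PosetInvolutionsEquivalent l₁ l₂) (hagree : AgreeOnScalars K ρ₁ ρ₂) :
    InvolutionsEquivalent K ρ₁ ρ₂ := by
  obtain ⟨α, hα⟩ := hposet
  set R : FinIncAlg K X ≃ₐ[K] FinIncAlg K X := relabel α
  let ρ : FinIncAlg K X →+ FinIncAlg K X :=
    (R : FinIncAlg K X →+ FinIncAlg K X).comp
      (ρ₁.comp (R.symm : FinIncAlg K X →+ FinIncAlg K X))
  have hρdef : ∀ a, ρ a = R (ρ₁ (R.symm a)) := fun a => rfl
  have hρ : IsAlgInvolution ρ :=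
    ⟨fun a b => by rw [hρdef, hρdef, hρdef, map_mul, hρ₁.map_mul_rev, map_mul],
      fun a => by rw [hρdef, hρdef, R.symm_apply_apply, hρ₁.apply_apply, R.apply_symm_apply]⟩
  have hind : Induces ρ l₂ := by
    intro x
    obtain ⟨u, hu⟩ := hind₁ (α.symm x)
    refine ⟨Units.map (R : FinIncAlg K X →* FinIncAlg K X) u, ?_⟩
    have h1 : R.symm (e x) = e (α.symm x) := by
      rw [AlgEquiv.symm_apply_eq, relabel_e, α.apply_symm_apply]
    rw [hρdef, h1, hu, map_mul, map_mul, relabel_e, hα, α.apply_symm_apply]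
    rfl
  have hagree' : AgreeOnScalars K ρ ρ₂ := by
    intro k
    rcases isEmpty_or_nonempty X with hX' | hX'
    · exact ext_apply fun x => isEmptyElim x
    · obtain ⟨τ, hτ⟩ := exists_ringHom_map_algebraMap hX hρ₁
      rw [← hagree, hρdef, AlgEquiv.commutes, hτ, AlgEquiv.commutes]
  obtain ⟨Φ, hΦ⟩ := involutionsEquivalent_of_induces_same h2 hX hinner hl₂ hfix₂ hρ hρ₂ hind hind₂
    hagree'
  refine ⟨R.trans Φ, fun a => ?_⟩
  rw [AlgEquiv.trans_apply, AlgEquiv.trans_apply, ← hΦ, hρdef, R.symm_apply_apply]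

end FinIncAlg

theorem theorem4p16 {K X : Type*} [Field K] [PartialOrder X]
    (hchar : ringChar K ≠ 2)
    (hX : IsConnectedPoset X)
    (hinner : ∀ Φ : FinIncAlg K X ≃ₐ[K] FinIncAlg K X,
      FinIncAlg.IsMultiplicativeAut Φ → IsInnerAut Φ)
    (l₁ l₂ : X → X) (hl₁ : IsPosetInvolution l₁) (hl₂ : IsPosetInvolution l₂)
    (hfix₁ : (Function.fixedPoints l₁).Subsingleton)
    (hfix₂ : (Function.fixedPoints l₂).Subsingleton)
    (ρ₁ ρ₂ : FinIncAlg K X →+ FinIncAlg K X)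
    (hρ₁ : IsSecondKindInvolution ρ₁) (hρ₂ : IsSecondKindInvolution ρ₂)
    (hind₁ : FinIncAlg.Induces ρ₁ l₁) (hind₂ : FinIncAlg.Induces ρ₂ l₂) :
    InvolutionsEquivalent K ρ₁ ρ₂ ↔
      PosetInvolutionsEquivalent l₁ l₂ ∧ AgreeOnScalars K ρ₁ ρ₂ :=
  ⟨FinIncAlg.posetInvolutionsEquivalent_and_agreeOnScalars hX hρ₁.toIsAlgInvolution
    hρ₂.toIsAlgInvolution hind₁ hind₂,
  fun h => FinIncAlg.involutionsEquivalent_of_posetInvolutionsEquivalent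
    (Ring.two_ne_zero hchar) hX hinner hl₂.apply_apply hfix₂ hρ₁.toIsAlgInvolution hρ₂ hind₁ hind₂
    h.1 h.2⟩
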